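/- Let $\mathbb T=\mathbb R/2\pi\mathbb Z$, and let $|D|:H^1(\mathbb T)\to L^2(\mathbb T)$ be given by $|D|u=\sum_{n\in\mathbb Z}|n|\,\widehat u(n)e^{inx}$. Let $\chi\in C^{0,\beta}(\mathbb T;\mathbb R)$ with $\frac12<\beta\le 1$, $\chi\ge 0$, $\chi\not\equiv 0$, and let $P(\tau)=|D|-i\tau\chi-\tau^2:H^1(\mathbb T)\to L^2(\mathbb T)$. 1. There is $C>0$ such that for all $\tau\in\mathbb R$ with $|\tau|>C$ the operator $P(\tau)$ is invertible and $\|P(\tau)^{-1}\|_{L^2\to L^2}\le C$. 2. If $\operatorname{supp}\chi\ne\mathbb T$, this bound is optimal: there are $c>0$ and arbitrarily large $\tau>0$ such that $P(\tau)$ is invertible and $\|P(\tau)^{-1}\|_{L^2\to L^2}\ge c$. In particular, there are no $\delta>0$ and $C>0$ such that, for all $\tau\in\mathbb R$ with $|\tau|>C$, $P(\tau)$ is invertible and $\|P(\tau)^{-1}\|_{L^2\to L^2}\le C|\tau|^{-\delta}$. 3. Suppose moreover that $\chi\in C^\infty(\mathbb T)$ has finite degeneracy, i.e. $\chi$ has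 finitely many zeros $x_1,\dots,x_n$, and for each $k$ there is an integer $N_k>0$ with $\chi^{(\ell)}(x_k)=0$ for $0\le\ell\le 2N_k-1$ and $\chi^{(2N_k)}(x_k)>0$. Let $N=\max_k N_k$ (with $N=0$ if $\chi$ has no zeros). Then for every $\gamma'>0$ there is $C>0$ such that for all $\tau\in\mathbb R$ with $|\tau|>C$ the operator $P(\tau)$ is invertible and $\|P(\tau)^{-1}\|_{L^2\to L^2}\le C|\tau|^{-\frac1{2N+1}+\gamma'}$. -/

import Mathlib

open MeasureTheory Real
open scoped ENNReal NNReal ContDiff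

namespace DampedWave

/-- The period `2π` is positive. -/
instance factTwoPiPos : Fact (0 < 2 * π) := ⟨Real.two_pi_pos⟩

/-- The circle `𝕋 = ℝ / 2πℤ`. -/
abbrev Circ : Type := AddCircle (2 * π)

/-- The complex Hilbert space `L²(𝕋)`. The measure is Haar measure of total mass one, i.e.
`dx / 2π`; operator norms on `L²` do not depend on this normalization. -/
abbrev L2 : Type := Lp ℂ 2 (AddCircle.haarAddCircle : Measure Circ)

/-- The sequence `n ↦ |n| û(n)`, with `û(n) = (2π)⁻¹ ∫ e^{-inx} u(x) dx`. -/
noncomputable def absCoeff (u : L2) (n : ℤ) : ℂ := ((|n| : ℤ) : ℂ) * fourierCoeff u n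

theorem absCoeff_add (u v : L2) : absCoeff (u + v) = absCoeff u + absCoeff v := by
  funext n
  simp only [absCoeff, Pi.add_apply, ← fourierBasis_repr, map_add, lp.coeFn_add]
  ring

theorem absCoeff_smul (c : ℂ) (u : L2) : absCoeff (c • u) = c • absCoeff u := by
  funext n
  simp only [absCoeff, Pi.smul_apply, ← fourierBasis_repr, map_smul, lp.coeFn_smul, smul_eq_mul]
  ring

/-- The Sobolev space `H¹(𝕋)`: those `u ∈ L²(𝕋)` with `∑ |n|² |û(n)|² < ∞`. -/
def H1 : Submodule ℂ L2 where
  carrier := {u | Memℓp (absCoeff u) 2}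
  add_mem' {u v} hu hv := by
    change Memℓp (absCoeff (u + v)) 2
    rw [absCoeff_add]
    exact Memℓp.add hu hv
  zero_mem' := by
    change Memℓp (absCoeff 0) 2
    have h := absCoeff_smul 0 0
    rw [zero_smul, zero_smul] at h
    rw [h]
    exact zero_memℓp
  smul_mem' c u hu := by
    change Memℓp (absCoeff (c • u)) 2
    rw [absCoeff_smul]
    exact Memℓp.const_smul hu c

/-- The operator `|D| : H¹(𝕋) → L²(𝕋)`, `|D| u = ∑ |n| û(n) e^{inx}`. -/
noncomputable def absD : H1 →ₗ[ℂ] L2 where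
  toFun u := fourierBasis.repr.symm (⟨absCoeff u, u.2⟩ : lp (fun _ : ℤ => ℂ) 2)
  map_add' u v := by
    rw [← map_add]
    congr 1
    exact Subtype.ext (absCoeff_add u v)
  map_smul' c u := by
    rw [RingHom.id_apply, ← map_smul]
    congr 1
    exact Subtype.ext (absCoeff_smul c u)

theorem memLp_mul (χ : C(Circ, ℝ)) (u : L2) :
    MemLp (fun x => (χ x : ℂ) * u x) 2 (AddCircle.haarAddCircle : Measure Circ) := by
  refine (Lp.memLp u).of_le_mul (c := ‖χ‖) ?_ (Filter.Eventually.of_forall fun x => ?_)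
  · exact (Complex.continuous_ofReal.comp χ.continuous).aestronglyMeasurable.mul
      (Lp.aestronglyMeasurable u)
  · rw [norm_mul, Complex.norm_real]
    exact mul_le_mul_of_nonneg_right (χ.norm_coe_le_norm x) (norm_nonneg _)

/-- Multiplication by the real continuous function `χ` on `L²(𝕋)`. -/
noncomputable def mulBy (χ : C(Circ, ℝ)) : L2 →ₗ[ℂ] L2 where
  toFun u := (memLp_mul χ u).toLp _
  map_add' u v := by
    rw [← MemLp.toLp_add, MemLp.toLp_eq_toLp_iff]
    filter_upwards [Lp.coeFn_add u v] with x hx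
    simp only [hx, Pi.add_apply, mul_add]
  map_smul' c u := by
    rw [RingHom.id_apply, ← MemLp.toLp_const_smul, MemLp.toLp_eq_toLp_iff]
    filter_upwards [Lp.coeFn_smul c u] with x hx
    simp only [hx, Pi.smul_apply, smul_eq_mul]
    ring

/-- The stationary operator `P(τ) = |D| - iτχ - τ² : H¹(𝕋) → L²(𝕋)`, `τ ∈ ℂ`. -/
noncomputable def P (χ : C(Circ, ℝ)) (τ : ℂ) : H1 →ₗ[ℂ] L2 :=
  absD - (Complex.I * τ) • (mulBy χ ∘ₗ H1.subtype) - τ ^ 2 • H1.subtype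

/-- `R` is the bounded operator `P(τ)⁻¹` on `L²(𝕋)`: it maps `L²(𝕋)` into `H¹(𝕋)` and is a two-sided
inverse of `P(τ) : H¹(𝕋) → L²(𝕋)`. -/
def IsResolvent (χ : C(Circ, ℝ)) (τ : ℂ) (R : L2 →L[ℂ] L2) : Prop :=
  (∀ f : L2, ∃ h : R f ∈ H1, P χ τ ⟨R f, h⟩ = f) ∧ ∀ u : H1, R (P χ τ u) = u

/-- The `2π`-periodic function on `ℝ` given by `χ`. -/
noncomputable def lift (χ : C(Circ, ℝ)) : ℝ → ℝ := fun t => χ (t : Circ)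

/-- `χ` vanishes at (the class of) `t` to order exactly `2m`, `m > 0`, with positive derivative of
order `2m`. -/
def VanishesToOrder (χ : C(Circ, ℝ)) (t : ℝ) (m : ℕ) : Prop :=
  0 < m ∧ (∀ l < 2 * m, iteratedDeriv l (lift χ) t = 0) ∧ 0 < iteratedDeriv (2 * m) (lift χ) t

/-- `χ ∈ C^∞(𝕋)`, `χ ≥ 0`, has finite degeneracy: it has finitely many zeros, and each of them is of
some finite order `2m` as above. -/
def FiniteDegeneracy (χ : C(Circ, ℝ)) : Prop :=
  ContDiff ℝ ∞ (lift χ) ∧ (∀ x, 0 ≤ χ x) ∧ {x : Circ | χ x = 0}.Finite ∧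
    ∀ t : ℝ, lift χ t = 0 → ∃ m, VanishesToOrder χ t m

/-- The maximum of the `m` over all zeros of `χ` (zero if `χ` has no zeros). -/
noncomputable def maxDegeneracy (χ : C(Circ, ℝ)) : ℕ :=
  sSup {m | ∃ t : ℝ, VanishesToOrder χ t m}

end DampedWave

/-!
The damping `χ` is real, so `P(τ)` splits along the Szegő projections onto the nonnegative and the
negative frequencies. There `|D| = ±D`, and `P(τ)` becomes, up to a factor `±i`, the transport
operator `∂ₓ ± τχ ∓ iτ²`. Solving the transport equation by Duhamel's formula around the circle and
applying Young's inequality bounds its inverse by `∫₀^{2π} κ / (1 - exp (-|τ| ∫ χ))`, where `κ r`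
majorizes `exp (-|τ| ∫ χ)` over all intervals of length `r` (`transportBound`).

Two errors have to be absorbed (`norm_trig_le`). The Szegő projection does not commute with `τχ`;
at the relevant frequencies `|n| ≈ τ²` the interaction between positive and negative frequencies
only sees the part of `χ` beyond frequency `τ² / 2`, which by Jackson's theorem has size
`O(τ ^ (-2β))` in the sup norm (`exists_trigPoly_approx`, `exists_norm_freqProj_mul_le`). As
`2β > 1`, this beats the factor `τ`. The low frequencies are controlled by ellipticity
(`norm_trig_low_le`) and by the energy identity `Im ⟨u, P(τ)u⟩ = -τ ∫ χ|u|²`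
(`abs_mul_norm_inner_le`), which makes `χu` small. All of this takes place for trigonometric
polynomials, and extends to `H¹` by density.

Since `P(τ)* = P(-τ)` satisfies the same estimate, `P(τ)` has closed and dense range, hence is
invertible (`exists_isResolvent`). With `κ = 1` this gives the uniform bound. If `χ` has finite
degeneracy, then `∫ χ` over an interval of length `r` is at least `c r ^ (2N + 1)`
(`FiniteDegeneracy.exists_integral_lower_bound`), so one can take
`κ r = exp (-c |τ| r ^ (2N + 1))`, whose integral is `O(|τ| ^ (-1 / (2N + 1)))`; no loss `γ'` in the
exponent occurs.

For the lower bound, a smooth `w` supported where `χ = 0` gives `u = e^{inx} w` with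
`‖P(√n) u‖ ≤ ‖w'‖`, because `||m| - n| ≤ |m - n|` on the Fourier side (`exists_quasimode`).
-/

namespace DampedWave

/-! ### Fourier coefficients and frequency projections on `L²(𝕋)` -/

/-- The inclusion of the continuous functions into `L²(𝕋)`. -/
noncomputable def toL2 : C(Circ, ℂ) →L[ℂ] L2 :=
  ContinuousMap.toLp 2 (AddCircle.haarAddCircle : Measure Circ) ℂ

/-- The `n`-th Fourier coefficient, as a linear functional on `L²(𝕋)`. -/
noncomputable def coef (n : ℤ) : L2 →ₗ[ℂ] ℂ where
  toFun u := fourierCoeff u n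
  map_add' u v := by
    simp only [← fourierBasis_repr, map_add, lp.coeFn_add, Pi.add_apply]
  map_smul' c u := by
    simp only [← fourierBasis_repr, map_smul, lp.coeFn_smul, Pi.smul_apply, RingHom.id_apply]

theorem coef_eq_repr (n : ℤ) (u : L2) : coef n u = fourierBasis.repr u n :=
  (fourierBasis_repr u n).symm

theorem coef_toL2 (n : ℤ) (w : C(Circ, ℂ)) : coef n (toL2 w) = fourierCoeff w n :=
  fourierCoeff_toLp w n

theorem ext_coef {u v : L2} (h : ∀ n, coef n u = coef n v) : u = v := by
  apply fourierBasis.repr.injective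
  ext n
  simpa only [coef_eq_repr] using h n

theorem hasSum_norm_coef_sq (u : L2) : HasSum (fun n => ‖coef n u‖ ^ 2) (‖u‖ ^ 2) := by
  have h := hasSum_sq_fourierCoeff u
  have h2 : ‖u‖ ^ 2 = ∫ t, ‖u t‖ ^ 2 ∂(AddCircle.haarAddCircle : Measure Circ) := by
    have h3 := congrArg RCLike.re (@L2.inner_def Circ ℂ ℂ _ _ _ _ _ u u)
    rw [← integral_re] at h3
    · simpa [← norm_sq_eq_re_inner, inner_self_eq_norm_sq_to_K, ← Complex.ofReal_pow] using h3
    · exact L2.integrable_inner u u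
  rw [h2]
  exact h

/-- Plancherel as a comparison principle: a pointwise inequality between Fourier coefficients is an
inequality between norms. -/
theorem norm_le_of_coef_le {u v : L2} {C : ℝ} (hC : 0 ≤ C)
    (h : ∀ n, ‖coef n u‖ ≤ C * ‖coef n v‖) : ‖u‖ ≤ C * ‖v‖ := by
  have h1 := hasSum_norm_coef_sq u
  have h2 := (hasSum_norm_coef_sq v).mul_left (C ^ 2)
  have h3 : ‖u‖ ^ 2 ≤ (C * ‖v‖) ^ 2 := by
    rw [mul_pow]
    refine hasSum_le (fun n => ?_) h1 h2
    rw [← mul_pow]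
    exact pow_le_pow_left₀ (norm_nonneg _) (h n) 2
  exact le_of_sq_le_sq h3 (by positivity)

theorem exists_coef_eq {a : ℤ → ℂ} (ha : Memℓp a 2) : ∃ u : L2, ∀ n, coef n u = a n :=
  ⟨fourierBasis.repr.symm ⟨a, ha⟩, fun n => by
    rw [coef_eq_repr, LinearIsometryEquiv.apply_symm_apply]⟩

theorem memlp_two_iff {a : ℤ → ℂ} : Memℓp a 2 ↔ Summable fun n => ‖a n‖ ^ 2 := by
  rw [memℓp_gen_iff (by norm_num)]
  norm_num

theorem memlp_indicator_coef (S : Set ℤ) (u : L2) :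
    Memℓp (S.indicator fun n => coef n u) 2 := by
  rw [memlp_two_iff]
  refine Summable.of_nonneg_of_le (fun n => by positivity) (fun n => ?_)
    (hasSum_norm_coef_sq u).summable
  exact pow_le_pow_left₀ (norm_nonneg _) (norm_indicator_le_norm_self _ n) 2

/-- The projection of `L²(𝕋)` onto the functions with frequencies in `S`. -/
noncomputable def freqProj (S : Set ℤ) : L2 →ₗ[ℂ] L2 where
  toFun u := (exists_coef_eq (memlp_indicator_coef S u)).choose
  map_add' u v := ext_coef fun n => by
    rw [map_add]
    simp only [(exists_coef_eq (memlp_indicator_coef S _)).choose_spec n]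
    by_cases h : n ∈ S <;> simp [h]
  map_smul' c u := ext_coef fun n => by
    rw [map_smul]
    simp only [(exists_coef_eq (memlp_indicator_coef S _)).choose_spec n]
    by_cases h : n ∈ S <;> simp [h]

theorem coef_freqProj (S : Set ℤ) (u : L2) (n : ℤ) :
    coef n (freqProj S u) = S.indicator (fun n => coef n u) n :=
  (exists_coef_eq (memlp_indicator_coef S u)).choose_spec n

theorem norm_freqProj_le (S : Set ℤ) (u : L2) : ‖freqProj S u‖ ≤ ‖u‖ := by
  rw [← one_mul ‖u‖]
  refine norm_le_of_coef_le zero_le_one fun n => ?_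
  rw [coef_freqProj, one_mul]
  exact norm_indicator_le_norm_self _ n

theorem freqProj_add_freqProj_compl (S : Set ℤ) (u : L2) :
    freqProj S u + freqProj Sᶜ u = u := ext_coef fun n => by
  rw [map_add, coef_freqProj, coef_freqProj]
  by_cases h : n ∈ S <;> simp [h]

theorem coef_toL2_fourier (m n : ℤ) : coef n (toL2 (fourier m)) = if n = m then 1 else 0 := by
  rw [coef_toL2, fourierCoeff_fourier, Pi.single_apply]

theorem coef_toL2_fourier_mul (k n : ℤ) (w : C(Circ, ℂ)) :
    coef n (toL2 (fourier k * w)) = coef (n - k) (toL2 w) := by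
  rw [coef_toL2, coef_toL2]
  unfold fourierCoeff
  congr 1
  funext t
  rw [ContinuousMap.mul_apply, smul_eq_mul, smul_eq_mul, ← mul_assoc, ← fourier_add]
  congr 3
  ring

theorem coeFn_toL2 (w : C(Circ, ℂ)) :
    toL2 w =ᵐ[(AddCircle.haarAddCircle : Measure Circ)] w :=
  ContinuousMap.coeFn_toLp _ w

theorem inner_toL2 (v w : C(Circ, ℂ)) : inner ℂ (toL2 v) (toL2 w) =
    ∫ t, inner ℂ (v t) (w t) ∂(AddCircle.haarAddCircle : Measure Circ) := by
  rw [L2.inner_def]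
  refine integral_congr_ae ?_
  filter_upwards [coeFn_toL2 v, coeFn_toL2 w] with t h1 h2
  rw [h1, h2]

theorem norm_toL2_sq (w : C(Circ, ℂ)) : ‖toL2 w‖ ^ 2 =
    ∫ t, ‖w t‖ ^ 2 ∂(AddCircle.haarAddCircle : Measure Circ) := by
  have h := inner_self_eq_norm_sq_to_K (𝕜 := ℂ) (toL2 w)
  rw [inner_toL2] at h
  simp only [inner_self_eq_norm_sq_to_K] at h
  have h2 : ((∫ t, ‖w t‖ ^ 2 ∂(AddCircle.haarAddCircle : Measure Circ) : ℝ) : ℂ)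
      = ((‖toL2 w‖ ^ 2 : ℝ) : ℂ) := by
    rw [← integral_complex_ofReal]
    push_cast
    exact h
  exact_mod_cast h2.symm

theorem norm_toL2_le_of_le {v w : C(Circ, ℂ)} {C : ℝ} (hC : 0 ≤ C)
    (h : ∀ t, ‖v t‖ ≤ C * ‖w t‖) : ‖toL2 v‖ ≤ C * ‖toL2 w‖ := by
  refine le_of_sq_le_sq ?_ (by positivity)
  rw [mul_pow, norm_toL2_sq, norm_toL2_sq, ← integral_const_mul]
  have hi : ∀ w : C(Circ, ℂ), Integrable (fun t => ‖w t‖ ^ 2)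
      (AddCircle.haarAddCircle : Measure Circ) := fun w =>
    (w.continuous.norm.pow 2).integrable_of_hasCompactSupport (HasCompactSupport.of_compactSpace _)
  refine integral_mono (hi v) ((hi w).const_mul _) fun t => ?_
  simp only [← mul_pow]
  exact pow_le_pow_left₀ (norm_nonneg _) (h t) 2

theorem norm_toL2_mul_le (φ w : C(Circ, ℂ)) : ‖toL2 (φ * w)‖ ≤ ‖φ‖ * ‖toL2 w‖ := by
  refine norm_toL2_le_of_le (norm_nonneg _) fun t => ?_
  rw [ContinuousMap.mul_apply, norm_mul]
  exact mul_le_mul_of_nonneg_right (φ.norm_coe_le_norm t) (norm_nonneg _)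

/-! ### Multiplication by the damping and the operator `P(τ)` -/

/-- The real function `χ` as a complex-valued continuous function. -/
noncomputable def complexify (χ : C(Circ, ℝ)) : C(Circ, ℂ) where
  toFun x := (χ x : ℂ)
  continuous_toFun := Complex.continuous_ofReal.comp χ.continuous

@[simp]
theorem complexify_apply (χ : C(Circ, ℝ)) (x : Circ) : complexify χ x = (χ x : ℂ) := rfl

theorem coeFn_mulBy (χ : C(Circ, ℝ)) (u : L2) :
    mulBy χ u =ᵐ[(AddCircle.haarAddCircle : Measure Circ)] fun x => (χ x : ℂ) * u x :=
  MemLp.coeFn_toLp (memLp_mul χ u)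

theorem mulBy_toL2 (χ : C(Circ, ℝ)) (w : C(Circ, ℂ)) :
    mulBy χ (toL2 w) = toL2 (complexify χ * w) := by
  apply Lp.ext
  filter_upwards [coeFn_mulBy χ (toL2 w), coeFn_toL2 w, coeFn_toL2 (complexify χ * w)]
    with x h1 h2 h3
  rw [h1, h2, h3, ContinuousMap.mul_apply, complexify_apply]

theorem norm_mulBy_le (χ : C(Circ, ℝ)) (u : L2) : ‖mulBy χ u‖ ≤ ‖χ‖ * ‖u‖ := by
  refine Lp.norm_le_mul_norm_of_ae_le_mul ?_
  filter_upwards [coeFn_mulBy χ u] with x hx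
  rw [hx, norm_mul, Complex.norm_real]
  exact mul_le_mul_of_nonneg_right (χ.norm_coe_le_norm x) (norm_nonneg _)

theorem continuous_mulBy (χ : C(Circ, ℝ)) : Continuous (mulBy χ) :=
  ((mulBy χ).mkContinuous ‖χ‖ (norm_mulBy_le χ)).continuous

theorem inner_mulBy_left (χ : C(Circ, ℝ)) (u v : L2) :
    inner ℂ (mulBy χ u) v = inner ℂ u (mulBy χ v) := by
  rw [L2.inner_def, L2.inner_def]
  refine integral_congr_ae ?_
  filter_upwards [coeFn_mulBy χ u, coeFn_mulBy χ v] with x h1 h2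
  rw [h1, h2]
  simp only [RCLike.inner_apply, map_mul, Complex.conj_ofReal]
  ring

/-- The `L²` norm of `χu` is controlled by the quadratic form `∫ χ|u|²`, since `χ² ≤ ‖χ‖ χ`. -/
theorem norm_mulBy_sq_le {χ : C(Circ, ℝ)} (hχ : ∀ x, 0 ≤ χ x) (u : L2) :
    ‖mulBy χ u‖ ^ 2 ≤ ‖χ‖ * ‖inner ℂ u (mulBy χ u)‖ := by
  have h1 : ‖mulBy χ u‖ ^ 2 = RCLike.re (inner ℂ (mulBy χ u) (mulBy χ u) : ℂ) := by
    rw [inner_self_eq_norm_sq]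
  have h2 : RCLike.re (inner ℂ u (mulBy χ u) : ℂ) ≤ ‖(inner ℂ u (mulBy χ u) : ℂ)‖ :=
    RCLike.re_le_norm _
  refine le_trans ?_ (mul_le_mul_of_nonneg_left h2 (norm_nonneg _))
  rw [h1, L2.inner_def, L2.inner_def, ← integral_re (L2.integrable_inner _ _),
    ← integral_re (L2.integrable_inner _ _), ← integral_const_mul]
  refine integral_mono_ae (L2.integrable_inner _ _).re
    ((L2.integrable_inner _ _).re.const_mul _) ?_
  filter_upwards [coeFn_mulBy χ u] with x hx
  simp only [hx, inner_self_eq_norm_sq]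
  have h3 : ∀ (r : ℝ) (z : ℂ), RCLike.re (inner ℂ z ((r : ℂ) * z) : ℂ) = r * ‖z‖ ^ 2 := by
    intro r z
    rw [← smul_eq_mul, inner_smul_right, inner_self_eq_norm_sq_to_K, ← RCLike.ofReal_pow]
    exact RCLike.re_ofReal_mul _ _ |>.trans (congrArg (r * ·) (RCLike.ofReal_re (K := ℂ) _))
  rw [h3, norm_mul, Complex.norm_real, mul_pow, norm_eq_abs, sq_abs, sq, mul_assoc]
  exact mul_le_mul_of_nonneg_right ((le_abs_self _).trans (χ.norm_coe_le_norm x))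
    (mul_nonneg (hχ x) (by positivity))

theorem mem_H1_iff {u : L2} : u ∈ H1 ↔ Memℓp (fun n : ℤ => ((|n| : ℤ) : ℂ) * coef n u) 2 :=
  Iff.rfl

theorem coef_absD (u : H1) (n : ℤ) : coef n (absD u) = ((|n| : ℤ) : ℂ) * coef n u := by
  rw [coef_eq_repr]
  change fourierBasis.repr (fourierBasis.repr.symm ⟨absCoeff u, u.2⟩) n = _
  rw [LinearIsometryEquiv.apply_symm_apply]
  rfl

theorem P_apply (χ : C(Circ, ℝ)) (τ : ℂ) (u : H1) :
    P χ τ u = absD u - (Complex.I * τ) • mulBy χ u - τ ^ 2 • (u : L2) := rfl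

theorem coef_P (χ : C(Circ, ℝ)) (τ : ℂ) (u : H1) (n : ℤ) : coef n (P χ τ u) =
    (((|n| : ℤ) : ℂ) - τ ^ 2) * coef n u - Complex.I * τ * coef n (mulBy χ u) := by
  rw [P_apply, map_sub, map_sub, map_smul, map_smul, coef_absD, smul_eq_mul, smul_eq_mul]
  ring

/-! ### Approximation by trigonometric polynomials -/

/-- The trigonometric polynomials of degree at most `d`. -/
noncomputable def trigPoly (d : ℕ) : Submodule ℂ C(Circ, ℂ) :=
  Submodule.span ℂ ((fun k : ℤ => (fourier k : C(Circ, ℂ))) '' {k | |k| ≤ d})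

theorem fourier_mem_trigPoly {d : ℕ} {k : ℤ} (hk : |k| ≤ d) :
    (fourier k : C(Circ, ℂ)) ∈ trigPoly d :=
  Submodule.subset_span ⟨k, hk, rfl⟩

theorem trigPoly_mono {a b : ℕ} (h : a ≤ b) : trigPoly a ≤ trigPoly b :=
  Submodule.span_mono (Set.image_mono fun k (hk : |k| ≤ a) =>
    hk.trans (by exact_mod_cast h))

theorem mul_mem_trigPoly {a b : ℕ} {f g : C(Circ, ℂ)} (hf : f ∈ trigPoly a)
    (hg : g ∈ trigPoly b) : f * g ∈ trigPoly (a + b) := by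
  have h := Submodule.mul_mem_mul hf hg
  rw [trigPoly, trigPoly, Submodule.span_mul_span] at h
  refine Submodule.span_mono ?_ h
  rintro _ ⟨_, ⟨k, hk, rfl⟩, _, ⟨l, hl, rfl⟩, rfl⟩
  refine ⟨k + l, ?_, ?_⟩
  · rw [Set.mem_ofPred_eq] at hk hl ⊢
    push_cast
    exact (abs_add_le k l).trans (add_le_add hk hl)
  · ext x
    simp

theorem integrable_of_continuous {E : Type*} [NormedAddCommGroup E] {f : Circ → E}
    (hf : Continuous f) : Integrable f (AddCircle.haarAddCircle : Measure Circ) :=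
  hf.integrable_of_hasCompactSupport (HasCompactSupport.of_compactSpace _)

/-- The convolution of a trigonometric polynomial with a continuous function is a trigonometric
polynomial of the same degree. -/
theorem exists_trigPoly_eq_convolution {d : ℕ} {J : C(Circ, ℂ)} (hJ : J ∈ trigPoly d)
    (f : C(Circ, ℂ)) : ∃ T ∈ trigPoly d, ∀ x, T x =
      ∫ t, J t * f (x - t) ∂(AddCircle.haarAddCircle : Measure Circ) := by
  induction hJ using Submodule.span_induction with
  | mem J hJ =>
    obtain ⟨k, hk, rfl⟩ := hJ
    refine ⟨(∫ t, fourier k (-t) * f t ∂(AddCircle.haarAddCircle : Measure Circ)) • fourier k,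
      Submodule.smul_mem _ _ (fourier_mem_trigPoly hk), fun x => ?_⟩
    rw [← integral_sub_left_eq_self (fun t => fourier k t * f (x - t))
      (AddCircle.haarAddCircle : Measure Circ) x, ContinuousMap.smul_apply, smul_eq_mul,
      ← integral_mul_const]
    refine integral_congr_ae (Filter.Eventually.of_forall fun t => ?_)
    have h : (fourier k (x - t) : ℂ) = fourier k x * fourier k (-t) := by
      simp only [fourier_apply, sub_eq_add_neg, smul_add, AddCircle.toCircle_add, Circle.coe_mul]
    simp only [h, sub_sub_cancel]
    ring
  | zero => exact ⟨0, Submodule.zero_mem _, fun x => by simp⟩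
  | add J₁ J₂ _ _ h₁ h₂ =>
    obtain ⟨T₁, hT₁, h₁⟩ := h₁
    obtain ⟨T₂, hT₂, h₂⟩ := h₂
    refine ⟨T₁ + T₂, Submodule.add_mem _ hT₁ hT₂, fun x => ?_⟩
    rw [ContinuousMap.add_apply, h₁, h₂, ← integral_add]
    · simp only [ContinuousMap.add_apply, add_mul]
    · exact integrable_of_continuous (by fun_prop)
    · exact integrable_of_continuous (by fun_prop)
  | smul c J _ h =>
    obtain ⟨T, hT, h⟩ := h
    refine ⟨c • T, Submodule.smul_mem _ _ hT, fun x => ?_⟩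
    rw [ContinuousMap.smul_apply, h, smul_eq_mul, ← integral_const_mul]
    simp only [ContinuousMap.smul_apply, smul_eq_mul, mul_assoc]

/-- The one-sided Dirichlet kernel `∑_{0 ≤ j < L} e^{ijx}`. The normalized fourth power of its
modulus is the Jackson kernel. -/
noncomputable def dirichlet (L : ℕ) : C(Circ, ℂ) :=
  ∑ j ∈ Finset.range L, fourier (j : ℤ)

/-- The fourth power of the modulus of the one-sided Dirichlet kernel, written so that it is
visibly a trigonometric polynomial. -/
noncomputable def jackson (L : ℕ) : C(Circ, ℂ) :=
  (dirichlet L * ∑ j ∈ Finset.range L, fourier (-(j : ℤ))) *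
    (dirichlet L * ∑ j ∈ Finset.range L, fourier (-(j : ℤ)))

theorem jackson_apply (L : ℕ) (t : Circ) :
    jackson L t = ((‖dirichlet L t‖ ^ 4 : ℝ) : ℂ) := by
  have h : (∑ j ∈ Finset.range L, fourier (-(j : ℤ)) : C(Circ, ℂ)) t
      = (starRingEnd ℂ) (dirichlet L t) := by
    simp only [dirichlet, ContinuousMap.coe_sum, Finset.sum_apply, map_sum, fourier_neg]
  simp only [jackson, ContinuousMap.mul_apply, h, Complex.mul_conj, Complex.normSq_eq_norm_sq]
  push_cast
  ring

theorem jackson_mem_trigPoly (L : ℕ) : jackson L ∈ trigPoly (4 * (L - 1)) := by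
  have h1 : dirichlet L ∈ trigPoly (L - 1) := Submodule.sum_mem _ fun j hj =>
    fourier_mem_trigPoly (by rw [Finset.mem_range] at hj; rw [Nat.abs_cast]; omega)
  have h2 : (∑ j ∈ Finset.range L, fourier (-(j : ℤ)) : C(Circ, ℂ)) ∈ trigPoly (L - 1) :=
    Submodule.sum_mem _ fun j hj =>
      fourier_mem_trigPoly (by rw [Finset.mem_range] at hj; rw [abs_neg, Nat.abs_cast]; omega)
  exact trigPoly_mono (by omega)
    (mul_mem_trigPoly (mul_mem_trigPoly h1 h2) (mul_mem_trigPoly h1 h2))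

theorem integral_norm_dirichlet_sq (L : ℕ) :
    ∫ t, ‖dirichlet L t‖ ^ 2 ∂(AddCircle.haarAddCircle : Measure Circ) = L := by
  rw [← norm_toL2_sq]
  have hc : ∀ n, coef n (toL2 (dirichlet L)) =
      if n ∈ (Finset.range L).map Nat.castEmbedding then 1 else 0 := by
    intro n
    simp only [dirichlet, map_sum, coef_toL2_fourier]
    by_cases h : n ∈ (Finset.range L).map Nat.castEmbedding
    · rw [if_pos h]
      obtain ⟨m, hm, rfl⟩ := Finset.mem_map.1 h
      simp only [Nat.castEmbedding_apply, Nat.cast_inj]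
      rw [Finset.sum_ite_eq, if_pos hm]
    · rw [if_neg h]
      refine Finset.sum_eq_zero fun j hj => if_neg ?_
      rintro rfl
      exact h (Finset.mem_map.2 ⟨j, hj, rfl⟩)
  have h1 := hasSum_norm_coef_sq (toL2 (dirichlet L))
  have h2 : HasSum (fun n => ‖coef n (toL2 (dirichlet L))‖ ^ 2)
      (∑ n ∈ (Finset.range L).map Nat.castEmbedding, ‖coef n (toL2 (dirichlet L))‖ ^ 2) :=
    hasSum_sum_of_ne_finset_zero fun n hn => by rw [hc, if_neg hn]; simp
  rw [h1.unique h2, Finset.sum_congr rfl (g := fun _ => (1 : ℝ))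
    fun n hn => by rw [hc, if_pos hn]; simp]
  simp

/-- The mass of the Jackson kernel before normalization. The square of the Dirichlet kernel has
`2L` possible frequencies and coefficients with sum `L²`, so Cauchy-Schwarz applies. -/
theorem pow_three_le_integral_dirichlet_pow_four {L : ℕ} (hL : 0 < L) :
    (L : ℝ) ^ 3 ≤ 2 * ∫ t, ‖dirichlet L t‖ ^ 4 ∂(AddCircle.haarAddCircle : Measure Circ) := by
  set v := toL2 (dirichlet L * dirichlet L) with hv
  have hZ : ∫ t, ‖dirichlet L t‖ ^ 4 ∂(AddCircle.haarAddCircle : Measure Circ) = ‖v‖ ^ 2 := by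
    rw [hv, norm_toL2_sq]
    refine integral_congr_ae (Filter.Eventually.of_forall fun t => ?_)
    simp only [ContinuousMap.mul_apply, norm_mul]
    ring
  have hsum : ∑ m ∈ Finset.range (2 * L), coef (m : ℤ) v = (L : ℂ) ^ 2 := by
    have h1 : ∀ m : ℕ, coef (m : ℤ) v =
        ∑ i ∈ Finset.range L, ∑ j ∈ Finset.range L, if m = i + j then 1 else 0 := by
      intro m
      have h2 : v = ∑ i ∈ Finset.range L, ∑ j ∈ Finset.range L,
          toL2 (fourier ((i + j : ℕ) : ℤ)) := by
        rw [hv, dirichlet, Finset.sum_mul_sum]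
        simp only [map_sum]
        refine Finset.sum_congr rfl fun i _ => Finset.sum_congr rfl fun j _ => ?_
        congr 1
        ext x
        simp
      simp only [h2, map_sum, coef_toL2_fourier, Nat.cast_inj]
    simp only [h1]
    rw [Finset.sum_comm]
    have h3 : ∀ i ∈ Finset.range L, ∑ m ∈ Finset.range (2 * L),
        ∑ j ∈ Finset.range L, (if m = i + j then (1 : ℂ) else 0) = L := by
      intro i hi
      rw [Finset.sum_comm, Finset.sum_congr rfl (g := fun _ => (1 : ℂ))]
      · simp
      · intro j hj
        rw [Finset.mem_range] at hi hj
        rw [Finset.sum_ite_eq', if_pos (Finset.mem_range.2 (by omega))]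
    rw [Finset.sum_congr rfl h3]
    simp [sq]
  have h1 : (L : ℝ) ^ 2 ≤ ∑ m ∈ Finset.range (2 * L), ‖coef (m : ℤ) v‖ := by
    have := norm_sum_le (Finset.range (2 * L)) fun m : ℕ => coef (m : ℤ) v
    rw [hsum] at this
    simpa using this
  have h2 := sq_sum_le_card_mul_sum_sq (s := Finset.range (2 * L))
    (f := fun m : ℕ => ‖coef (m : ℤ) v‖)
  have h3 : ∑ m ∈ Finset.range (2 * L), ‖coef (m : ℤ) v‖ ^ 2 ≤ ‖v‖ ^ 2 := by
    have h4 := sum_le_hasSum ((Finset.range (2 * L)).map Nat.castEmbedding)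
      (fun n _ => by positivity) (hasSum_norm_coef_sq v)
    rwa [Finset.sum_map] at h4
  have h4 : ((L : ℝ) ^ 2) ^ 2 ≤ 2 * L * ‖v‖ ^ 2 := by
    refine (pow_le_pow_left₀ (by positivity) h1 2).trans (h2.trans ?_)
    rw [Finset.card_range]
    push_cast
    exact mul_le_mul_of_nonneg_left h3 (by positivity)
  rw [hZ]
  have hL' : (0 : ℝ) < L := by exact_mod_cast hL
  refine le_of_mul_le_mul_left ?_ hL'
  nlinarith [h4]

theorem norm_dirichlet_mul_le (L : ℕ) (t : Circ) :
    ‖dirichlet L t‖ * ‖1 - (fourier 1 t : ℂ)‖ ≤ 2 := by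
  have h1 : dirichlet L t = ∑ j ∈ Finset.range L, (fourier 1 t : ℂ) ^ j := by
    simp only [dirichlet, ContinuousMap.coe_sum, Finset.sum_apply]
    refine Finset.sum_congr rfl fun j _ => ?_
    simp [fourier_apply, AddCircle.toCircle_nsmul]
  have hn : ‖(fourier 1 t : ℂ)‖ = 1 := by
    rw [fourier_apply]
    exact Circle.norm_coe _
  rw [← norm_mul, mul_comm, h1, mul_neg_geom_sum]
  refine (norm_sub_le _ _).trans ?_
  rw [norm_one, norm_pow, hn, one_pow]
  norm_num

theorem integral_dirichlet_pow_four_mul_le (L : ℕ) :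
    ∫ t, ‖dirichlet L t‖ ^ 4 * ‖1 - (fourier 1 t : ℂ)‖ ^ 2
      ∂(AddCircle.haarAddCircle : Measure Circ) ≤ 4 * L := by
  rw [← integral_norm_dirichlet_sq, ← integral_const_mul]
  refine integral_mono (integrable_of_continuous (by fun_prop))
    (integrable_of_continuous (by fun_prop)) fun t => ?_
  have h := pow_le_pow_left₀ (by positivity) (norm_dirichlet_mul_le L t) 2
  nlinarith [mul_le_mul_of_nonneg_left h (sq_nonneg ‖dirichlet L t‖)]

theorem norm_le_norm_one_sub_fourier (t : Circ) :
    ‖t‖ ≤ π / 2 * ‖1 - (fourier 1 t : ℂ)‖ := by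
  obtain ⟨x, hx, rfl⟩ : ∃ x : ℝ, |x| ≤ π ∧ (x : Circ) = t := by
    obtain ⟨x, hx, hxt⟩ := (AddCircle.coe_image_Icc_eq (2 * π) (-π)).symm.subset (Set.mem_univ t)
    exact ⟨x, abs_le.2 ⟨hx.1, by linarith [hx.2]⟩, hxt⟩
  have h1 : ‖(x : Circ)‖ = |x| := by
    refine (AddCircle.norm_coe_eq_abs_iff _ Real.two_pi_pos.ne').2 ?_
    rw [abs_of_pos Real.two_pi_pos]
    linarith
  have h2 : ‖1 - (fourier 1 (x : Circ) : ℂ)‖ = 2 * |sin (x / 2)| := by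
    rw [fourier_coe_apply, norm_sub_rev]
    have : (2 * (π : ℂ) * Complex.I * ((1 : ℤ) : ℂ) * x / ((2 * π : ℝ) : ℂ)) = Complex.I * x := by
      have : (π : ℂ) ≠ 0 := by exact_mod_cast pi_ne_zero
      push_cast
      field_simp
    rw [this, Complex.norm_exp_I_mul_ofReal_sub_one, norm_mul, norm_eq_abs, norm_eq_abs,
      abs_of_pos (two_pos)]
  have h3 : 2 / π * |x / 2| ≤ |sin (x / 2)| :=
    Real.mul_abs_le_abs_sin (by rw [abs_div, abs_of_pos (two_pos : (0 : ℝ) < 2)]; linarith)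
  rw [h1, h2]
  rw [abs_div, abs_of_pos (two_pos : (0 : ℝ) < 2)] at h3
  have h4 := mul_le_mul_of_nonneg_left h3 pi_pos.le
  have h5 : π * (2 / π * (|x| / 2)) = |x| := by
    field_simp
  linarith

/-- **Jackson's theorem**: a `β`-Hölder function on the circle is within `O(M ^ (-β))` of a
trigonometric polynomial of degree less than `M`. -/
theorem exists_trigPoly_approx {χ : C(Circ, ℝ)} {β K : ℝ≥0} (hβ1 : β ≤ 1)
    (hχ : HolderWith K β χ) : ∃ C : ℝ, 0 ≤ C ∧ ∀ M : ℕ, 0 < M →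
      ∃ T ∈ trigPoly (M - 1), ‖complexify χ - T‖ ≤ C * (M : ℝ) ^ (-(β : ℝ)) := by
  refine ⟨K * (1 + 2 * π ^ 2) * 4, by positivity, fun M hM => ?_⟩
  set L := (M + 3) / 4 with hL
  have hL0 : 0 < L := by omega
  have hLR : (0 : ℝ) < L := by exact_mod_cast hL0
  set Z := ∫ t, ‖dirichlet L t‖ ^ 4 ∂(AddCircle.haarAddCircle : Measure Circ) with hZ
  have hZL : (L : ℝ) ^ 3 ≤ 2 * Z := pow_three_le_integral_dirichlet_pow_four hL0
  have hZ0 : 0 < Z := by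
    have : (0 : ℝ) < (L : ℝ) ^ 3 := by positivity
    linarith
  obtain ⟨T, hT, hTx⟩ := exists_trigPoly_eq_convolution (jackson_mem_trigPoly L) (complexify χ)
  refine ⟨(Z⁻¹ : ℂ) • T, Submodule.smul_mem _ _ (trigPoly_mono (by omega) hT), ?_⟩
  -- `‖t‖ ^ β ≤ δ ^ β (1 + (‖t‖ / δ)²)` with `δ = 1 / L` reduces to the second moment.
  have hmom : ∀ t : Circ, ‖t‖ ^ (β : ℝ) ≤
      (L : ℝ) ^ (-(β : ℝ)) * (1 + (L : ℝ) ^ 2 * (π ^ 2 / 4) * ‖1 - (fourier 1 t : ℂ)‖ ^ 2) := by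
    intro t
    have h1 : ‖t‖ ^ (β : ℝ) = (L : ℝ) ^ (-(β : ℝ)) * (L * ‖t‖) ^ (β : ℝ) := by
      rw [mul_rpow hLR.le (norm_nonneg _), ← mul_assoc, ← rpow_add hLR, neg_add_cancel,
        rpow_zero, one_mul]
    have h2 : (L * ‖t‖) ^ (β : ℝ) ≤ 1 + (L * ‖t‖) ^ 2 := by
      rcases le_total (L * ‖t‖) 1 with h | h
      · have := rpow_le_one (by positivity) h β.coe_nonneg
        nlinarith [sq_nonneg (L * ‖t‖)]
      · have h3 := rpow_le_rpow_of_exponent_le h (show (β : ℝ) ≤ 1 by exact_mod_cast hβ1)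
        rw [rpow_one] at h3
        nlinarith
    have h3 := pow_le_pow_left₀ (norm_nonneg _) (norm_le_norm_one_sub_fourier t) 2
    rw [h1]
    refine mul_le_mul_of_nonneg_left (h2.trans ?_) (by positivity)
    rw [mul_pow]
    nlinarith [mul_le_mul_of_nonneg_left h3 (sq_nonneg (L : ℝ))]
  have hpt : ∀ x, ‖(complexify χ - (Z⁻¹ : ℂ) • T) x‖ ≤
      K * (1 + 2 * π ^ 2) * (L : ℝ) ^ (-(β : ℝ)) := by
    intro x
    have h1 : (complexify χ - (Z⁻¹ : ℂ) • T) x = (Z⁻¹ : ℂ) *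
        ((∫ t, ‖dirichlet L t‖ ^ 4 * (χ x - χ (x - t))
          ∂(AddCircle.haarAddCircle : Measure Circ) : ℝ) : ℂ) := by
      have hT : T x = ((∫ t, ‖dirichlet L t‖ ^ 4 * χ (x - t)
          ∂(AddCircle.haarAddCircle : Measure Circ) : ℝ) : ℂ) := by
        rw [hTx, ← integral_complex_ofReal]
        simp only [jackson_apply, complexify_apply, Complex.ofReal_mul]
      simp only [mul_sub]
      rw [integral_sub (integrable_of_continuous (by fun_prop))
        (integrable_of_continuous (by fun_prop)), integral_mul_const, ← hZ,
        ContinuousMap.sub_apply, ContinuousMap.smul_apply, hT, complexify_apply, smul_eq_mul]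
      have : (Z : ℂ) ≠ 0 := by exact_mod_cast hZ0.ne'
      push_cast
      field_simp
    rw [h1, norm_mul, norm_inv, Complex.norm_real, Complex.norm_real, norm_eq_abs Z,
      abs_of_pos hZ0]
    have h2 : ‖∫ t, ‖dirichlet L t‖ ^ 4 * (χ x - χ (x - t))
        ∂(AddCircle.haarAddCircle : Measure Circ)‖ ≤
        ∫ t, (K * (L : ℝ) ^ (-(β : ℝ))) * (‖dirichlet L t‖ ^ 4 + (L : ℝ) ^ 2 * (π ^ 2 / 4) *
          (‖dirichlet L t‖ ^ 4 * ‖1 - (fourier 1 t : ℂ)‖ ^ 2))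
          ∂(AddCircle.haarAddCircle : Measure Circ) := by
      refine norm_integral_le_of_norm_le (integrable_of_continuous (by fun_prop))
        (Filter.Eventually.of_forall fun t => ?_)
      have h3 := hχ.dist_le x (x - t)
      rw [dist_eq_norm, dist_eq_norm, sub_sub_cancel] at h3
      rw [norm_mul, norm_pow, norm_norm]
      calc ‖dirichlet L t‖ ^ 4 * ‖χ x - χ (x - t)‖ ≤
            ‖dirichlet L t‖ ^ 4 * (K * ((L : ℝ) ^ (-(β : ℝ)) *
              (1 + (L : ℝ) ^ 2 * (π ^ 2 / 4) * ‖1 - (fourier 1 t : ℂ)‖ ^ 2))) := by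
              refine mul_le_mul_of_nonneg_left (h3.trans ?_) (by positivity)
              exact mul_le_mul_of_nonneg_left (hmom t) K.2
        _ = _ := by ring
    rw [integral_const_mul, integral_add (integrable_of_continuous (by fun_prop))
      (integrable_of_continuous (by fun_prop)), integral_const_mul, ← hZ] at h2
    have h4 : Z + (L : ℝ) ^ 2 * (π ^ 2 / 4) * ∫ t, ‖dirichlet L t‖ ^ 4 *
        ‖1 - (fourier 1 t : ℂ)‖ ^ 2 ∂(AddCircle.haarAddCircle : Measure Circ) ≤
        (1 + 2 * π ^ 2) * Z := by
      have h5 := mul_le_mul_of_nonneg_left (integral_dirichlet_pow_four_mul_le L)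
        (show 0 ≤ (L : ℝ) ^ 2 * (π ^ 2 / 4) by positivity)
      have h6 := mul_le_mul_of_nonneg_left hZL (sq_nonneg π)
      nlinarith
    calc Z⁻¹ * _ ≤ Z⁻¹ * ((K * (L : ℝ) ^ (-(β : ℝ))) * ((1 + 2 * π ^ 2) * Z)) := by
          refine mul_le_mul_of_nonneg_left (h2.trans ?_) (inv_nonneg.2 hZ0.le)
          exact mul_le_mul_of_nonneg_left h4 (by positivity)
      _ = K * (1 + 2 * π ^ 2) * (L : ℝ) ^ (-(β : ℝ)) := by field_simp
  refine ((ContinuousMap.norm_le _ (by positivity)).2 hpt).trans ?_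
  rw [mul_assoc _ (4 : ℝ)]
  refine mul_le_mul_of_nonneg_left ?_ (by positivity)
  have hMR : (0 : ℝ) < M := by exact_mod_cast hM
  have h1 : (M : ℝ) / 4 ≤ L := by
    have : (M : ℝ) ≤ 4 * L := by exact_mod_cast (by omega : M ≤ 4 * L)
    linarith
  calc (L : ℝ) ^ (-(β : ℝ)) ≤ ((M : ℝ) / 4) ^ (-(β : ℝ)) :=
        rpow_le_rpow_of_nonpos (by positivity) h1 (by simp)
    _ = 4 ^ (β : ℝ) * (M : ℝ) ^ (-(β : ℝ)) := by
        rw [div_rpow hMR.le (by norm_num), rpow_neg (by norm_num : (0 : ℝ) ≤ 4), div_inv_eq_mul,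
          mul_comm]
    _ ≤ 4 * (M : ℝ) ^ (-(β : ℝ)) := by
        refine mul_le_mul_of_nonneg_right ?_ (by positivity)
        have := rpow_le_rpow_of_exponent_le (by norm_num : (1 : ℝ) ≤ 4)
          (show (β : ℝ) ≤ 1 by exact_mod_cast hβ1)
        rwa [rpow_one] at this

theorem freqProj_trigPoly_mul_eq_zero {d : ℕ} {T w : C(Circ, ℂ)} (hT : T ∈ trigPoly d)
    {S : Set ℤ} (h : ∀ n ∈ S, ∀ k : ℤ, |k| ≤ d → coef (n - k) (toL2 w) = 0) :
    freqProj S (toL2 (T * w)) = 0 := by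
  induction hT using Submodule.span_induction with
  | mem J hJ =>
    obtain ⟨k, hk, rfl⟩ := hJ
    refine ext_coef fun n => ?_
    rw [coef_freqProj, map_zero]
    by_cases hn : n ∈ S
    · rw [Set.indicator_of_mem hn, coef_toL2_fourier_mul, h n hn k hk]
    · rw [Set.indicator_of_notMem hn]
  | zero => simp
  | add J₁ J₂ _ _ h₁ h₂ => rw [add_mul, map_add, map_add, h₁, h₂, add_zero]
  | smul c J _ h => rw [smul_mul_assoc, map_smul, map_smul, h, smul_zero]

/-- A Hankel-type estimate: multiplication by a `β`-Hölder function moves only `O(M ^ (-β))` of a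
function to frequencies at distance at least `M` from its spectrum. -/
theorem exists_norm_freqProj_mul_le {χ : C(Circ, ℝ)} {β K : ℝ≥0} (hβ1 : β ≤ 1)
    (hχ : HolderWith K β χ) : ∃ C : ℝ, 0 ≤ C ∧ ∀ M : ℕ, 0 < M → ∀ (S : Set ℤ) (w : C(Circ, ℂ)),
      (∀ n ∈ S, ∀ k : ℤ, |k| < M → coef (n - k) (toL2 w) = 0) →
      ‖freqProj S (toL2 (complexify χ * w))‖ ≤ C * (M : ℝ) ^ (-(β : ℝ)) * ‖toL2 w‖ := by
  obtain ⟨C, hC, h⟩ := exists_trigPoly_approx hβ1 hχ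
  refine ⟨C, hC, fun M hM S w hw => ?_⟩
  obtain ⟨T, hT, hTC⟩ := h M hM
  have h0 := freqProj_trigPoly_mul_eq_zero hT fun n hn k hk => hw n hn k (by omega)
  have h1 : freqProj S (toL2 (complexify χ * w)) =
      freqProj S (toL2 ((complexify χ - T) * w)) := by
    rw [sub_mul, map_sub, map_sub, h0, sub_zero]
  rw [h1]
  exact (norm_freqProj_le _ _).trans ((norm_toL2_mul_le _ _).trans
    (mul_le_mul_of_nonneg_right hTC (norm_nonneg _)))

/-! ### The damped transport equation on the circle -/

theorem continuous_lift (χ : C(Circ, ℝ)) : Continuous (lift χ) :=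
  χ.continuous.comp (AddCircle.continuous_mk' _)

theorem periodic_lift (χ : C(Circ, ℝ)) : Function.Periodic (lift χ) (2 * π) := fun x => by
  simp only [lift, AddCircle.coe_add_period]

theorem integral_lift_sub_period (χ : C(Circ, ℝ)) (x : ℝ) :
    ∫ s in (x - 2 * π)..x, lift χ s = ∫ s in (0 : ℝ)..(2 * π), lift χ s := by
  have h := (periodic_lift χ).intervalIntegral_add_eq (x - 2 * π) 0
  rwa [sub_add_cancel, zero_add] at h

theorem norm_toL2_comp_neg (w : C(Circ, ℂ)) :
    ‖toL2 (w.comp ⟨Neg.neg, continuous_neg⟩)‖ = ‖toL2 w‖ := by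
  refine (sq_eq_sq₀ (norm_nonneg _) (norm_nonneg _)).1 ?_
  rw [norm_toL2_sq, norm_toL2_sq]
  exact integral_neg_eq_self (fun t => ‖w t‖ ^ 2) _

theorem sq_integral_mul_le {κ h : ℝ → ℝ} (hκ : Continuous κ) (hh : Continuous h)
    (hκ0 : ∀ r, 0 < κ r) {b : ℝ} (hb : 0 < b) :
    (∫ r in (0 : ℝ)..b, κ r * h r) ^ 2 ≤
      (∫ r in (0 : ℝ)..b, κ r) * ∫ r in (0 : ℝ)..b, κ r * h r ^ 2 := by
  set K := ∫ r in (0 : ℝ)..b, κ r with hK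
  set m := ∫ r in (0 : ℝ)..b, κ r * h r with hm
  have hK0 : 0 < K := intervalIntegral.intervalIntegral_pos_of_pos (hκ.intervalIntegrable _ _)
    hκ0 hb
  have h1 : 0 ≤ ∫ r in (0 : ℝ)..b, κ r * (K * h r - m) ^ 2 :=
    intervalIntegral.integral_nonneg hb.le fun r _ => mul_nonneg (hκ0 r).le (sq_nonneg _)
  have h2 : ∫ r in (0 : ℝ)..b, κ r * (K * h r - m) ^ 2 =
      K ^ 2 * (∫ r in (0 : ℝ)..b, κ r * h r ^ 2) - 2 * K * m * m + m ^ 2 * K := by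
    have : ∀ r, κ r * (K * h r - m) ^ 2 =
        K ^ 2 * (κ r * h r ^ 2) - 2 * K * m * (κ r * h r) + m ^ 2 * κ r := fun r => by ring
    simp only [this]
    rw [intervalIntegral.integral_add, intervalIntegral.integral_sub,
      intervalIntegral.integral_const_mul, intervalIntegral.integral_const_mul,
      intervalIntegral.integral_const_mul]
    all_goals exact Continuous.intervalIntegrable (by fun_prop) _ _
  rw [h2] at h1
  refine le_of_mul_le_mul_left ?_ hK0
  nlinarith

/-- Young's inequality for the convolution of a continuous function on the circle with a kernel
supported in one period. -/
theorem norm_toL2_le_of_le_convolution {κ : ℝ → ℝ} (hκ : Continuous κ) (hκ0 : ∀ r, 0 < κ r)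
    {G g : C(Circ, ℂ)} {b : ℝ} (hb : 0 ≤ b)
    (h : ∀ y, b * ‖G y‖ ≤ ∫ r in (0 : ℝ)..(2 * π), κ r * ‖g (y - (r : Circ))‖) :
    b * ‖toL2 G‖ ≤ (∫ r in (0 : ℝ)..(2 * π), κ r) * ‖toL2 g‖ := by
  set K := ∫ r in (0 : ℝ)..(2 * π), κ r with hK
  have hK0 : 0 ≤ K := intervalIntegral.integral_nonneg Real.two_pi_pos.le fun r _ => (hκ0 r).le
  have hcoe : Continuous fun r : ℝ => (r : Circ) := AddCircle.continuous_mk' _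
  refine le_of_sq_le_sq ?_ (by positivity)
  rw [mul_pow, mul_pow, norm_toL2_sq, norm_toL2_sq, ← integral_const_mul]
  have hF : Continuous fun p : ℝ × Circ => κ p.1 * ‖g (p.2 - (p.1 : Circ))‖ ^ 2 := by
    fun_prop
  have hint : Integrable (Function.uncurry fun (r : ℝ) (y : Circ) =>
      κ r * ‖g (y - (r : Circ))‖ ^ 2) ((volume.restrict (Set.uIoc 0 (2 * π))).prod
        (AddCircle.haarAddCircle : Measure Circ)) := by
    have h1 : IntegrableOn (fun p : ℝ × Circ => κ p.1 * ‖g (p.2 - (p.1 : Circ))‖ ^ 2)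
        (Set.uIcc 0 (2 * π) ×ˢ Set.univ) (volume.prod AddCircle.haarAddCircle) :=
      hF.continuousOn.integrableOn_compact (isCompact_uIcc.prod isCompact_univ)
    have h2 := h1.mono_set (Set.prod_mono Set.uIoc_subset_uIcc (Set.Subset.refl Set.univ))
    rw [IntegrableOn, ← Measure.prod_restrict, Measure.restrict_univ] at h2
    exact h2
  calc ∫ y, b ^ 2 * ‖G y‖ ^ 2 ∂(AddCircle.haarAddCircle : Measure Circ)
      ≤ ∫ y, (K * ∫ r in (0 : ℝ)..(2 * π), κ r * ‖g (y - (r : Circ))‖ ^ 2)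
        ∂(AddCircle.haarAddCircle : Measure Circ) := by
        refine integral_mono (integrable_of_continuous (by fun_prop)) ?_ fun y => ?_
        · refine Integrable.const_mul ?_ K
          simp only [intervalIntegral.integral_of_le Real.two_pi_pos.le]
          rw [Set.uIoc_of_le Real.two_pi_pos.le] at hint
          exact hint.integral_prod_right
        · simp only [← mul_pow]
          refine (pow_le_pow_left₀ (by positivity) (h y) 2).trans ?_
          exact sq_integral_mul_le hκ (by fun_prop) hκ0 Real.two_pi_pos
    _ = K * ∫ r in (0 : ℝ)..(2 * π), (∫ y, κ r * ‖g (y - (r : Circ))‖ ^ 2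
        ∂(AddCircle.haarAddCircle : Measure Circ)) := by
        rw [integral_const_mul, intervalIntegral_integral_swap hint]
    _ = K ^ 2 * ∫ y, ‖g y‖ ^ 2 ∂(AddCircle.haarAddCircle : Measure Circ) := by
        have h1 : ∀ r : ℝ, ∫ y, κ r * ‖g (y - (r : Circ))‖ ^ 2
            ∂(AddCircle.haarAddCircle : Measure Circ) =
            κ r * ∫ y, ‖g y‖ ^ 2 ∂(AddCircle.haarAddCircle : Measure Circ) := by
          intro r
          rw [integral_const_mul, integral_sub_right_eq_self (fun y => ‖g y‖ ^ 2)]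
        simp only [h1]
        rw [intervalIntegral.integral_mul_const]
        ring

/-- Duhamel's formula over one period: the value of a periodic solution of
`w' + (aχ + iσ) w = g` at `x` returns to itself damped by `exp (-a ∫ χ)`. -/
theorem norm_mul_le_integral_of_hasDerivAt (χ : C(Circ, ℝ)) (a σ : ℝ) {w v : C(Circ, ℂ)}
    (hw : ∀ t : ℝ, HasDerivAt (fun s : ℝ => w (s : Circ)) (v (t : Circ)) t) (x : ℝ) :
    (1 - exp (-a * ∫ s in (0 : ℝ)..(2 * π), lift χ s)) * ‖w (x : Circ)‖ ≤
      ∫ s in (x - 2 * π)..x, exp (-a * ∫ r in s..x, lift χ r) *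
        ‖(v + ((a : ℂ) • complexify χ) * w + (σ * Complex.I) • w) (s : Circ)‖ := by
  set g := v + ((a : ℂ) • complexify χ) * w + (σ * Complex.I) • w with hg
  have hcoe : Continuous fun r : ℝ => (r : Circ) := AddCircle.continuous_mk' _
  have hint : ∀ s t, IntervalIntegrable (lift χ) volume s t := fun s t =>
    (continuous_lift χ).intervalIntegrable s t
  -- the integrating factor based at the right endpoint
  set Φ : ℝ → ℂ := fun s => Complex.exp (((-a * ∫ r in s..x, lift χ r : ℝ) : ℂ) +
    σ * Complex.I * (s - x)) with hΦ
  have hI : ∀ s, HasDerivAt (fun s => ∫ r in s..x, lift χ r) (-lift χ s) s := fun s =>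
    intervalIntegral.integral_hasDerivAt_left (hint s x)
      ((continuous_lift χ).stronglyMeasurableAtFilter _ _) (continuous_lift χ).continuousAt
  have hΦd : ∀ s, HasDerivAt Φ (Φ s * (a * lift χ s + σ * Complex.I)) s := by
    intro s
    have h1 := ((hI s).const_mul (-a)).ofReal_comp
    have h2 : HasDerivAt (fun s : ℝ => σ * Complex.I * ((s : ℂ) - x)) (σ * Complex.I * 1) s :=
      ((Complex.ofRealCLM.hasDerivAt (x := s)).sub_const _).const_mul _
    have h3 := (h1.fun_add h2).cexp
    convert h3 using 1
    simp only [hΦ]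
    push_cast
    ring
  have hd : ∀ s, HasDerivAt (fun s : ℝ => Φ s * w (s : Circ)) (Φ s * g (s : Circ)) s := by
    intro s
    refine ((hΦd s).fun_mul (hw s)).congr_deriv ?_
    simp only [hg, ContinuousMap.add_apply, ContinuousMap.mul_apply, ContinuousMap.smul_apply,
      complexify_apply, smul_eq_mul, lift]
    ring
  have hΦc : Continuous Φ := continuous_iff_continuousAt.2 fun s => (hΦd s).continuousAt
  have hFTC := intervalIntegral.integral_eq_sub_of_hasDerivAt (a := x - 2 * π) (b := x)
    (fun s _ => hd s) ((hΦc.mul (g.continuous.comp hcoe)).intervalIntegrable _ _)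
  have hΦn : ∀ s, ‖Φ s‖ = exp (-a * ∫ r in s..x, lift χ r) := by
    intro s
    rw [hΦ, Complex.norm_exp]
    congr 1
    have : (σ * Complex.I * ((s : ℂ) - x)) = ((σ * (s - x) : ℝ) : ℂ) * Complex.I := by
      push_cast
      ring
    rw [this, Complex.add_re, Complex.ofReal_re, Complex.re_ofReal_mul, Complex.I_re, mul_zero,
      add_zero]
  have hx : Φ x = 1 := by simp [hΦ]
  have hper : w ((x - 2 * π : ℝ) : Circ) = w (x : Circ) := by
    rw [AddCircle.coe_sub, AddCircle.coe_period, sub_zero]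
  rw [hx, one_mul, hper] at hFTC
  calc _ = ‖w (x : Circ)‖ - ‖Φ (x - 2 * π) * w (x : Circ)‖ := by
        rw [norm_mul, hΦn, integral_lift_sub_period]
        ring
    _ ≤ ‖w (x : Circ) - Φ (x - 2 * π) * w (x : Circ)‖ := norm_sub_norm_le _ _
    _ ≤ ∫ s in (x - 2 * π)..x, ‖Φ s * g (s : Circ)‖ := by
        rw [← hFTC]
        exact intervalIntegral.norm_integral_le_integral_norm (by linarith [Real.two_pi_pos])
    _ = _ := by simp only [norm_mul, hΦn]

/-- The transport operator `∂ₓ + aχ + iσ` on the circle is bounded below by `1 / k` on `L²`, for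
all real `σ`. -/
def TransportBound (χ : C(Circ, ℝ)) (a k : ℝ) : Prop :=
  ∀ (σ : ℝ) (w v : C(Circ, ℂ)),
    (∀ t : ℝ, HasDerivAt (fun s : ℝ => w (s : Circ)) (v (t : Circ)) t) →
      ‖toL2 w‖ ≤ k * ‖toL2 (v + ((a : ℂ) • complexify χ) * w + (σ * Complex.I) • w)‖

theorem transportBound_of_pos {χ : C(Circ, ℝ)} (hA : 0 < ∫ s in (0 : ℝ)..(2 * π), lift χ s)
    {a : ℝ} (ha : 0 < a) {κ : ℝ → ℝ} (hκ : Continuous κ) (hκ0 : ∀ r, 0 < κ r)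
    (h : ∀ x, ∀ r ∈ Set.Icc 0 (2 * π), exp (-a * ∫ s in (x - r)..x, lift χ s) ≤ κ r) :
    TransportBound χ a ((∫ r in (0 : ℝ)..(2 * π), κ r) /
      (1 - exp (-a * ∫ s in (0 : ℝ)..(2 * π), lift χ s))) := by
  intro σ w v hw
  have hb : 0 < 1 - exp (-a * ∫ s in (0 : ℝ)..(2 * π), lift χ s) := by
    rw [sub_pos, exp_lt_one_iff, neg_mul, neg_lt_zero]
    exact mul_pos ha hA
  rw [div_mul_eq_mul_div, le_div_iff₀' hb]
  refine norm_toL2_le_of_le_convolution hκ hκ0 hb.le fun y => ?_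
  induction y using QuotientAddGroup.induction_on with
  | H x =>
  refine (norm_mul_le_integral_of_hasDerivAt χ a σ hw x).trans ?_
  set g := v + ((a : ℂ) • complexify χ) * w + (σ * Complex.I) • w with hg
  have hcoe : Continuous fun r : ℝ => (r : Circ) := AddCircle.continuous_mk' _
  have hsub := intervalIntegral.integral_comp_sub_left (a := 0) (b := 2 * π)
    (fun s : ℝ => exp (-a * ∫ r in s..x, lift χ r) * ‖g (s : Circ)‖) x
  rw [sub_zero] at hsub
  rw [← hsub]
  have hI : Continuous fun r => ∫ s in (x - r)..x, lift χ s := by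
    have h1 : Continuous fun s => ∫ r in x..s, lift χ r :=
      intervalIntegral.continuous_primitive
        (fun _ _ => (continuous_lift χ).intervalIntegrable _ _) x
    simp only [fun r => intervalIntegral.integral_symm (f := lift χ) (μ := volume) x (x - r)]
    fun_prop
  refine intervalIntegral.integral_mono_on Real.two_pi_pos.le
    (Continuous.intervalIntegrable (by fun_prop) _ _)
    (Continuous.intervalIntegrable (by fun_prop) _ _) fun r hr => ?_
  refine mul_le_mul (h x r hr) (le_of_eq ?_) (norm_nonneg _) (hκ0 r).le
  rfl

/-- A lower bound for the damping accumulated over intervals, in the form of a majorant `κ` of the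
propagator, bounds the inverse of the transport operator in both directions. -/
theorem transportBound {χ : C(Circ, ℝ)} (hA : 0 < ∫ s in (0 : ℝ)..(2 * π), lift χ s)
    {a : ℝ} (ha : a ≠ 0) {κ : ℝ → ℝ} (hκ : Continuous κ) (hκ0 : ∀ r, 0 < κ r)
    (h : ∀ x, ∀ r ∈ Set.Icc 0 (2 * π), exp (-|a| * ∫ s in (x - r)..x, lift χ s) ≤ κ r) :
    TransportBound χ a ((∫ r in (0 : ℝ)..(2 * π), κ r) /
      (1 - exp (-|a| * ∫ s in (0 : ℝ)..(2 * π), lift χ s))) := by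
  rcases ha.lt_or_gt with ha | ha
  · rw [abs_of_neg ha] at h ⊢
    -- the reflection `x ↦ -x` changes the sign of `a`
    set χ' : C(Circ, ℝ) := χ.comp ⟨Neg.neg, continuous_neg⟩ with hχ'
    have hl : ∀ s, lift χ' s = lift χ (-s) := fun s => by
      simp only [lift, hχ', ContinuousMap.comp_apply, ContinuousMap.coe_mk, AddCircle.coe_neg]
    have hA' : ∫ s in (0 : ℝ)..(2 * π), lift χ' s = ∫ s in (0 : ℝ)..(2 * π), lift χ s := by
      simp only [hl]
      rw [intervalIntegral.integral_comp_neg, ← integral_lift_sub_period χ (-0)]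
      simp
    have key := transportBound_of_pos (χ := χ') (hA'.symm ▸ hA) (neg_pos.2 ha) hκ hκ0 (by
      intro x r hr
      refine le_trans (le_of_eq ?_) (h (-x + r) r hr)
      simp only [hl]
      rw [intervalIntegral.integral_comp_neg (fun s => lift χ s), neg_sub, add_sub_cancel_right,
        sub_eq_neg_add])
    rw [hA'] at key
    intro σ w v hw
    have h1 := key (-σ) (w.comp ⟨Neg.neg, continuous_neg⟩) (-(v.comp ⟨Neg.neg, continuous_neg⟩))
      (by
        intro t
        have h2 := (hw (-t)).scomp t (hasDerivAt_neg t)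
        refine HasDerivAt.congr_deriv h2 ?_
        rw [neg_smul, one_smul]
        rfl)
    have h2 : -(v.comp ⟨Neg.neg, continuous_neg⟩ : C(Circ, ℂ)) +
        (((-a : ℝ) : ℂ) • complexify χ') * w.comp ⟨Neg.neg, continuous_neg⟩ +
        (((-σ : ℝ) : ℂ) * Complex.I) • w.comp ⟨Neg.neg, continuous_neg⟩ =
        -((v + ((a : ℂ) • complexify χ) * w + (σ * Complex.I) • w).comp
          ⟨Neg.neg, continuous_neg⟩) := by
      ext t
      simp only [ContinuousMap.add_apply, ContinuousMap.neg_apply, ContinuousMap.comp_apply,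
        ContinuousMap.coe_mk, ContinuousMap.mul_apply, ContinuousMap.smul_apply, complexify_apply,
        smul_eq_mul, hχ', Complex.ofReal_neg]
      ring
    rwa [h2, map_neg, norm_neg, norm_toL2_comp_neg, norm_toL2_comp_neg] at h1
  · rw [abs_of_pos ha] at h ⊢
    exact transportBound_of_pos hA ha hκ hκ0 h

theorem TransportBound.mono {χ : C(Circ, ℝ)} {a k k' : ℝ} (h : TransportBound χ a k)
    (hk : k ≤ k') : TransportBound χ a k' := fun σ w v hw =>
  (h σ w v hw).trans (mul_le_mul_of_nonneg_right hk (norm_nonneg _))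

/-- The version of `transportBound` for `|a| ≥ 1`, where the propagator over a full period is at
most `exp (-∫ χ)`. -/
theorem transportBound_of_one_le {χ : C(Circ, ℝ)}
    (hA : 0 < ∫ s in (0 : ℝ)..(2 * π), lift χ s) {a : ℝ} (ha : 1 ≤ |a|) {κ : ℝ → ℝ}
    (hκ : Continuous κ) (hκ0 : ∀ r, 0 < κ r)
    (h : ∀ x, ∀ r ∈ Set.Icc 0 (2 * π), exp (-|a| * ∫ s in (x - r)..x, lift χ s) ≤ κ r)
    {K : ℝ} (hK : ∫ r in (0 : ℝ)..(2 * π), κ r ≤ K) :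
    TransportBound χ a (K / (1 - exp (-∫ s in (0 : ℝ)..(2 * π), lift χ s))) := by
  have ha0 : a ≠ 0 := abs_pos.1 (one_pos.trans_le ha)
  refine (transportBound hA ha0 hκ hκ0 h).mono ?_
  have h1 : 0 ≤ ∫ r in (0 : ℝ)..(2 * π), κ r :=
    intervalIntegral.integral_nonneg Real.two_pi_pos.le fun r _ => (hκ0 r).le
  refine div_le_div₀ (h1.trans hK) hK (sub_pos.2 (exp_lt_one_iff.2 (neg_lt_zero.2 hA))) ?_
  refine sub_le_sub_left (exp_le_exp.2 ?_) 1
  nlinarith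

/-! ### The a priori estimate for trigonometric polynomials -/

/-- The trigonometric polynomial `∑_{n ∈ F} c n e^{inx}`. -/
noncomputable def trig (F : Finset ℤ) (c : ℤ → ℂ) : C(Circ, ℂ) :=
  ∑ n ∈ F, c n • fourier n

theorem coef_trig (F : Finset ℤ) (c : ℤ → ℂ) (n : ℤ) :
    coef n (toL2 (trig F c)) = if n ∈ F then c n else 0 := by
  simp only [trig, map_sum, map_smul, coef_toL2_fourier, smul_eq_mul, mul_ite, mul_one, mul_zero]
  rw [Finset.sum_ite_eq]

theorem toL2_trig (F : Finset ℤ) (c : ℤ → ℂ) :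
    toL2 (trig F c) = ∑ n ∈ F, c n • (fourierLp 2 n : L2) := by
  simp only [trig, map_sum, map_smul]
  rfl

theorem hasDerivAt_trig (F : Finset ℤ) (c : ℤ → ℂ) (t : ℝ) :
    HasDerivAt (fun s : ℝ => trig F c (s : Circ))
      (trig F (fun n => Complex.I * n * c n) (t : Circ)) t := by
  simp only [trig, ContinuousMap.coe_sum, Finset.sum_apply, ContinuousMap.smul_apply, smul_eq_mul]
  refine HasDerivAt.fun_sum fun n _ => ?_
  refine ((hasDerivAt_fourier (2 * π) n t).const_mul (c n)).congr_deriv ?_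
  have : (π : ℂ) ≠ 0 := by exact_mod_cast pi_ne_zero
  push_cast
  field_simp

theorem norm_trig_le_of_subset {G F : Finset ℤ} (h : G ⊆ F) (c : ℤ → ℂ) :
    ‖toL2 (trig G c)‖ ≤ ‖toL2 (trig F c)‖ := by
  rw [← one_mul ‖toL2 (trig F c)‖]
  refine norm_le_of_coef_le zero_le_one fun n => ?_
  rw [coef_trig, coef_trig, one_mul]
  by_cases hn : n ∈ G
  · rw [if_pos hn, if_pos (h hn)]
  · rw [if_neg hn, norm_zero]
    exact norm_nonneg _

theorem trig_filter_add_trig_filter_not (F : Finset ℤ) (p : ℤ → Prop) [DecidablePred p]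
    (c : ℤ → ℂ) : trig (F.filter p) c + trig (F.filter fun n => ¬ p n) c = trig F c :=
  Finset.sum_filter_add_sum_filter_not F p _

theorem freqProj_trig (S : Set ℤ) [DecidablePred (· ∈ S)] (F : Finset ℤ) (c : ℤ → ℂ) :
    freqProj S (toL2 (trig F c)) = toL2 (trig (F.filter (· ∈ S)) c) := ext_coef fun n => by
  rw [coef_freqProj, coef_trig]
  by_cases h : n ∈ S
  · simp [h, coef_trig]
  · simp [h]

/-- `P(τ)` applied to a trigonometric polynomial. -/
noncomputable def PTrig (χ : C(Circ, ℝ)) (τ : ℝ) (F : Finset ℤ) (c : ℤ → ℂ) : L2 :=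
  toL2 (trig F fun n => ((|n| : ℤ) : ℂ) * c n) - (Complex.I * τ) • toL2 (complexify χ * trig F c) -
    (τ : ℂ) ^ 2 • toL2 (trig F c)

/-- Interaction of `χ` between the frequencies in `G` and those in `S` on the other side of zero:
the part of the spectrum beyond `M` is handled by the regularity of `χ`, which leaves the low
frequencies. -/
theorem norm_freqProj_mul_trig_le {χ : C(Circ, ℝ)} {M : ℕ} {E : ℝ} (hE0 : 0 ≤ E)
    (hE : ∀ (S : Set ℤ) (w : C(Circ, ℂ)),
      (∀ n ∈ S, ∀ k : ℤ, |k| < M → coef (n - k) (toL2 w) = 0) →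
      ‖freqProj S (toL2 (complexify χ * w))‖ ≤ E * ‖toL2 w‖)
    {S : Set ℤ} {G F : Finset ℤ} (hGF : G ⊆ F) (hS : ∀ n ∈ S, ∀ m ∈ G, |m| ≤ |n - m|)
    (c : ℤ → ℂ) :
    ‖freqProj S (toL2 (complexify χ * trig G c))‖ ≤ E * ‖toL2 (trig F c)‖ +
      ‖complexify χ‖ * ‖toL2 (trig (F.filter fun m => |m| < M) c)‖ := by
  rw [← trig_filter_add_trig_filter_not G (fun m => |m| < M) c, mul_add, map_add, map_add,
    add_comm]
  refine (norm_add_le _ _).trans (add_le_add ?_ ?_)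
  · refine (hE S _ fun n hn k hk => ?_).trans (mul_le_mul_of_nonneg_left
      (norm_trig_le_of_subset ((Finset.filter_subset _ _).trans hGF) c) hE0)
    rw [coef_trig, if_neg]
    intro hm
    rw [Finset.mem_filter] at hm
    have := hS n hn _ hm.1
    rw [sub_sub_cancel] at this
    exact hm.2 (this.trans_lt hk)
  · refine (norm_freqProj_le _ _).trans ((norm_toL2_mul_le _ _).trans
      (mul_le_mul_of_nonneg_left (norm_trig_le_of_subset ?_ c) (norm_nonneg _)))
    exact Finset.filter_subset_filter _ hGF

/-- The damping absorbs the energy: this is the imaginary part of `⟨u, P(τ)u⟩`. -/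
theorem abs_mul_norm_inner_le (χ : C(Circ, ℝ)) (τ : ℝ) (F : Finset ℤ) (c : ℤ → ℂ) :
    |τ| * ‖(inner ℂ (toL2 (trig F c)) (mulBy χ (toL2 (trig F c))) : ℂ)‖ ≤
      ‖toL2 (trig F c)‖ * ‖PTrig χ τ F c‖ := by
  set u := toL2 (trig F c) with hu
  have h1 : (inner ℂ u (toL2 (trig F fun n => ((|n| : ℤ) : ℂ) * c n)) : ℂ).im = 0 := by
    rw [hu, toL2_trig, toL2_trig, orthonormal_fourier.inner_sum, Complex.im_sum]
    refine Finset.sum_eq_zero fun n _ => ?_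
    rw [mul_left_comm, ← Complex.normSq_eq_conj_mul_self]
    simp [← Complex.ofReal_intCast]
  have h2 : (inner ℂ u (mulBy χ u) : ℂ).im = 0 := by
    rw [← Complex.conj_eq_iff_im, inner_conj_symm, inner_mulBy_left]
  have h3 : (inner ℂ u (PTrig χ τ F c) : ℂ).im = -τ * (inner ℂ u (mulBy χ u) : ℂ).re := by
    rw [PTrig, ← mulBy_toL2, ← hu, inner_sub_right, inner_sub_right, inner_smul_right,
      inner_smul_right, inner_self_eq_norm_sq_to_K, Complex.sub_im, Complex.sub_im, h1]
    have h4 : ((τ : ℂ) ^ 2 * ((‖u‖ : ℝ) : ℂ) ^ 2).im = 0 := by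
      rw [← Complex.ofReal_pow, ← Complex.ofReal_pow, ← Complex.ofReal_mul, Complex.ofReal_im]
    have h5 : (Complex.I * τ * (inner ℂ u (mulBy χ u) : ℂ)).im =
        τ * (inner ℂ u (mulBy χ u) : ℂ).re := by
      simp [Complex.mul_im, Complex.mul_re]
    rw [h5]
    erw [h4]
    ring
  have h4 : ‖(inner ℂ u (mulBy χ u) : ℂ)‖ = |(inner ℂ u (mulBy χ u) : ℂ).re| :=
    (Complex.abs_re_eq_norm.2 h2).symm
  calc _ = |(inner ℂ u (PTrig χ τ F c) : ℂ).im| := by rw [h3, h4, abs_mul, abs_neg]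
    _ ≤ ‖(inner ℂ u (PTrig χ τ F c) : ℂ)‖ := Complex.abs_im_le_norm _
    _ ≤ _ := norm_inner_le_norm _ _

/-- Away from the characteristic frequencies `|n| ≈ τ²` the operator `|D| - τ²` is elliptic. -/
theorem norm_trig_low_le {χ : C(Circ, ℝ)} {τ : ℝ} (hτ : 0 < |τ|) {M : ℕ}
    (hM : (M : ℝ) ≤ τ ^ 2 / 2) (F : Finset ℤ) (c : ℤ → ℂ) :
    ‖toL2 (trig (F.filter fun m => |m| < M) c)‖ ≤
      2 / |τ| ^ 2 * (‖PTrig χ τ F c‖ + |τ| * ‖mulBy χ (toL2 (trig F c))‖) := by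
  have h1 : ‖toL2 (trig (F.filter fun m => |m| < M) c)‖ ≤ 2 / |τ| ^ 2 *
      ‖PTrig χ τ F c + (Complex.I * τ) • mulBy χ (toL2 (trig F c))‖ := by
    refine norm_le_of_coef_le (by positivity) fun n => ?_
    have h2 : PTrig χ τ F c + (Complex.I * τ) • mulBy χ (toL2 (trig F c)) =
        toL2 (trig F fun n => ((|n| : ℤ) : ℂ) * c n) - (τ : ℂ) ^ 2 • toL2 (trig F c) := by
      rw [PTrig, mulBy_toL2]
      abel
    rw [h2, coef_trig, map_sub, map_smul, coef_trig, coef_trig]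
    by_cases hn : n ∈ F.filter fun m => |m| < (M : ℤ)
    · rw [if_pos hn]
      rw [Finset.mem_filter] at hn
      rw [if_pos hn.1, if_pos hn.1, smul_eq_mul, ← sub_mul, norm_mul, ← mul_assoc]
      refine le_mul_of_one_le_left (norm_nonneg _) ?_
      have h3 : (((|n| : ℤ) : ℂ) - (τ : ℂ) ^ 2) = (((|n| : ℤ) : ℝ) - τ ^ 2 : ℝ) := by
        rw [Complex.ofReal_sub, Complex.ofReal_intCast, Complex.ofReal_pow]
      have h4 : ((|n| : ℤ) : ℝ) < M := by exact_mod_cast hn.2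
      rw [h3, Complex.norm_real, norm_eq_abs,
        abs_of_neg (a := ((|n| : ℤ) : ℝ) - τ ^ 2) (by nlinarith [sq_nonneg τ]),
        div_mul_eq_mul_div, le_div_iff₀ (by positivity), sq_abs]
      linarith
    · rw [if_neg hn, norm_zero]
      positivity
  refine h1.trans (mul_le_mul_of_nonneg_left ((norm_add_le _ _).trans ?_) (by positivity))
  rw [norm_smul, norm_mul, Complex.norm_I, one_mul, Complex.norm_real, norm_eq_abs]

/-- The a priori estimate before the choice of constants. The Szegő projections turn `P(τ)` into
two transport operators, up to the interaction `E` of high frequencies of opposite sign and the low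
frequencies. -/
theorem norm_trig_le {χ : C(Circ, ℝ)} {M : ℕ} {E : ℝ} (hE0 : 0 ≤ E)
    (hE : ∀ (S : Set ℤ) (w : C(Circ, ℂ)),
      (∀ n ∈ S, ∀ k : ℤ, |k| < M → coef (n - k) (toL2 w) = 0) →
      ‖freqProj S (toL2 (complexify χ * w))‖ ≤ E * ‖toL2 w‖)
    {τ k : ℝ} (hk : 0 ≤ k) (hpos : TransportBound χ τ k) (hneg : TransportBound χ (-τ) k)
    (F : Finset ℤ) (c : ℤ → ℂ) :
    ‖toL2 (trig F c)‖ ≤ 2 * k * (‖PTrig χ τ F c‖ + 2 * |τ| * (E * ‖toL2 (trig F c)‖ +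
      ‖complexify χ‖ * ‖toL2 (trig (F.filter fun m => |m| < M) c)‖)) := by
  set S : Set ℤ := {n | 0 ≤ n} with hS
  classical
  set Fp := F.filter (· ∈ S) with hFp
  set Fm := F.filter (· ∈ Sᶜ) with hFm
  have hFp' : ∀ n ∈ Fp, |n| = n := fun n hn => abs_of_nonneg (Finset.mem_filter.1 hn).2
  have hFm' : ∀ n ∈ Fm, |n| = -n := fun n hn =>
    abs_of_neg (not_le.1 (Finset.mem_filter.1 hn).2)
  have hsplit : ∀ c, trig Fp c + trig Fm c = trig F c := fun c => by
    convert trig_filter_add_trig_filter_not F (· ∈ S) c using 2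
    rw [hFm]
    congr
  set R := E * ‖toL2 (trig F c)‖ +
      ‖complexify χ‖ * ‖toL2 (trig (F.filter fun m => |m| < M) c)‖ with hR
  set xp := toL2 (complexify χ * trig Fp c) with hxp
  set xm := toL2 (complexify χ * trig Fm c) with hxm
  have hm : ‖freqProj S xm‖ ≤ R := by
    refine norm_freqProj_mul_trig_le hE0 hE (Finset.filter_subset _ _) (fun n hn m hm => ?_) c
    have h1 : 0 ≤ n := hn
    have h2 := hFm' m hm
    rw [h2]
    exact le_trans (by linarith) (le_abs_self _)
  have hp : ‖freqProj Sᶜ xp‖ ≤ R := by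
    refine norm_freqProj_mul_trig_le hE0 hE (Finset.filter_subset _ _) (fun n hn m hm => ?_) c
    have h1 : n < 0 := not_le.1 hn
    have h2 := hFp' m hm
    rw [h2, abs_sub_comm]
    exact le_trans (by linarith) (le_abs_self _)
  have hx : toL2 (complexify χ * trig F c) = xp + xm := by
    rw [← hsplit c, mul_add, map_add]
  have hbound : ∀ (y z : L2), ‖y‖ ≤ ‖PTrig χ τ F c‖ → ‖z‖ ≤ 2 * R →
      ‖y + (Complex.I * τ) • z‖ ≤ ‖PTrig χ τ F c‖ + 2 * |τ| * R := by
    intro y z hy hz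
    refine (norm_add_le _ _).trans (add_le_add hy ?_)
    rw [norm_smul, norm_mul, Complex.norm_I, one_mul, Complex.norm_real, norm_eq_abs]
    nlinarith [mul_le_mul_of_nonneg_left hz (abs_nonneg τ)]
  have hup : ‖toL2 (trig Fp c)‖ ≤ k * (‖PTrig χ τ F c‖ + 2 * |τ| * R) := by
    refine (hpos (-τ ^ 2) (trig Fp c) _ (hasDerivAt_trig Fp c)).trans
      (mul_le_mul_of_nonneg_left ?_ hk)
    have h1 : toL2 (trig Fp (fun n => Complex.I * n * c n) +
        ((τ : ℂ) • complexify χ) * trig Fp c + (((-τ ^ 2 : ℝ) : ℂ) * Complex.I) • trig Fp c) =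
        Complex.I • (freqProj S (PTrig χ τ F c) + (Complex.I * τ) •
          (freqProj S xm - freqProj Sᶜ xp)) := by
      have h2 : trig Fp (fun n => Complex.I * n * c n) =
          Complex.I • trig Fp (fun n => ((|n| : ℤ) : ℂ) * c n) := by
        simp only [trig, Finset.smul_sum, smul_smul]
        refine Finset.sum_congr rfl fun n hn => ?_
        rw [hFp' n hn, mul_assoc]
      have h3 : xp = freqProj S xp + freqProj Sᶜ xp := (freqProj_add_freqProj_compl S xp).symm
      rw [PTrig, hx, map_sub, map_sub, map_smul, map_smul, map_add, freqProj_trig, freqProj_trig,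
        ← hFp, smul_mul_assoc, map_add, map_add, map_smul, map_smul, ← hxp, h2, map_smul]
      nth_rewrite 1 [h3]
      push_cast
      match_scalars <;> ring_nf <;> simp
    rw [h1, norm_smul, Complex.norm_I, one_mul]
    refine hbound _ _ (norm_freqProj_le _ _) ((norm_sub_le _ _).trans ?_)
    linarith
  have hum : ‖toL2 (trig Fm c)‖ ≤ k * (‖PTrig χ τ F c‖ + 2 * |τ| * R) := by
    refine (hneg (τ ^ 2) (trig Fm c) _ (hasDerivAt_trig Fm c)).trans
      (mul_le_mul_of_nonneg_left ?_ hk)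
    have h1 : toL2 (trig Fm (fun n => Complex.I * n * c n) +
        (((-τ : ℝ) : ℂ) • complexify χ) * trig Fm c + (((τ ^ 2 : ℝ) : ℂ) * Complex.I) • trig Fm c) =
        (-Complex.I) • (freqProj Sᶜ (PTrig χ τ F c) + (Complex.I * τ) •
          (freqProj Sᶜ xp - freqProj S xm)) := by
      have h2 : trig Fm (fun n => Complex.I * n * c n) =
          (-Complex.I) • trig Fm (fun n => ((|n| : ℤ) : ℂ) * c n) := by
        simp only [trig, Finset.smul_sum, smul_smul]
        refine Finset.sum_congr rfl fun n hn => ?_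
        rw [hFm' n hn]
        push_cast
        ring_nf
      have h3 : xm = freqProj S xm + freqProj Sᶜ xm := (freqProj_add_freqProj_compl S xm).symm
      rw [PTrig, hx, map_sub, map_sub, map_smul, map_smul, map_add, freqProj_trig, freqProj_trig,
        ← hFm, smul_mul_assoc, map_add, map_add, map_smul, map_smul, ← hxm, h2, map_smul]
      nth_rewrite 1 [h3]
      push_cast
      match_scalars <;> ring_nf <;> simp
    rw [h1, norm_smul, norm_neg, Complex.norm_I, one_mul]
    refine hbound _ _ (norm_freqProj_le _ _) ((norm_sub_le _ _).trans ?_)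
    linarith
  have h1 : ‖toL2 (trig F c)‖ ≤ ‖toL2 (trig Fp c)‖ + ‖toL2 (trig Fm c)‖ := by
    nth_rewrite 1 [← hsplit c]
    rw [map_add]
    exact norm_add_le _ _
  linarith

theorem rpow_neg_natFloor_le {t b : ℝ} (ht : 2 < t) (hb0 : 0 ≤ b) (hb1 : b ≤ 1) :
    t * (⌊t ^ 2 / 2⌋₊ : ℝ) ^ (-b) ≤ 4 * t ^ (-(2 * b - 1)) := by
  have ht0 : 0 < t := by linarith
  have hMge : t ^ 2 / 4 ≤ (⌊t ^ 2 / 2⌋₊ : ℝ) := by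
    have h1 := Nat.lt_floor_add_one (t ^ 2 / 2)
    nlinarith
  have h1 : (⌊t ^ 2 / 2⌋₊ : ℝ) ^ (-b) ≤ 4 * t ^ (-(2 * b)) := by
    calc (⌊t ^ 2 / 2⌋₊ : ℝ) ^ (-b) ≤ (t ^ 2 / 4) ^ (-b) :=
          rpow_le_rpow_of_nonpos (by positivity) hMge (by simpa using hb0)
      _ = 4 ^ b * t ^ (-(2 * b)) := by
          rw [div_rpow (by positivity) (by norm_num), rpow_neg (by norm_num : (0 : ℝ) ≤ 4),
            div_inv_eq_mul, mul_comm, ← rpow_natCast, ← rpow_mul ht0.le]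
          push_cast
          rw [mul_neg]
      _ ≤ 4 * t ^ (-(2 * b)) := by
          refine mul_le_mul_of_nonneg_right ?_ (by positivity)
          have := rpow_le_rpow_of_exponent_le (by norm_num : (1 : ℝ) ≤ 4) hb1
          rwa [rpow_one] at this
  have h2 : t * t ^ (-(2 * b)) = t ^ (-(2 * b - 1)) := by
    rw [neg_sub, sub_eq_add_neg, rpow_add ht0, rpow_one]
  calc _ ≤ t * (4 * t ^ (-(2 * b))) := mul_le_mul_of_nonneg_left h1 ht0.le
    _ = 4 * t ^ (-(2 * b - 1)) := by rw [← h2]; ring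

/-- The bookkeeping of the a priori estimate. Here `U = ‖u‖`, `f = ‖P(τ)u‖`, `X = ‖χu‖`,
`lo` is the norm of the low-frequency part and `q = ∫ χ|u|²`. -/
theorem absorb_error_terms {U f X lo q t E B k k₀ δ : ℝ} (hU : 0 ≤ U) (hf : 0 ≤ f)
    (hq : 0 ≤ q) (hE : 0 ≤ E) (hB : 0 ≤ B) (hk : 0 ≤ k) (hk' : k ≤ k₀) (ht : 2 < t)
    (hδ : 0 < δ) (hδk : 32 * (B + 1) * k₀ * δ = 1) (hEt : 16 * k₀ * (t * E) ≤ 1)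
    (hmain : U ≤ 2 * k * (f + 2 * t * (E * U + B * lo)))
    (hlow : lo ≤ 2 / t ^ 2 * (f + t * X)) (henergy : t * q ≤ U * f) (hX : X ^ 2 ≤ B * q) :
    U ≤ 2 * (2 + 8 * B + 8 * B * (B / δ)) * k * f := by
  have ht0 : 0 < t := by linarith
  have hXle : X ≤ δ * U + B / δ * f := by
    refine le_of_sq_le_sq ?_ (by positivity)
    have h1 : q ≤ U * f := by nlinarith
    have h2 : (δ * U + B / δ * f) ^ 2 =
        (δ * U) ^ 2 + (B / δ * f) ^ 2 + 2 * (B * (U * f)) := by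
      field_simp
      ring
    have h3 := mul_nonneg hB (mul_nonneg hU hf)
    have h4 := sq_nonneg (δ * U)
    have h5 := sq_nonneg (B / δ * f)
    have h6 := mul_le_mul_of_nonneg_left h1 hB
    rw [h2]
    linarith
  have hlo' : t * lo ≤ f + 2 * X := by
    have h1 := mul_le_mul_of_nonneg_left hlow ht0.le
    have h2 : t * (2 / t ^ 2 * (f + t * X)) = 2 / t * f + 2 * X := by field_simp
    have h3 : 2 / t ≤ 1 := by rw [div_le_one ht0]; exact ht.le
    have h4 := mul_le_mul_of_nonneg_right h3 hf
    linarith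
  have h1 : 4 * k * (t * E * U) ≤ U / 4 := by
    have h2 : 16 * k * (t * E) ≤ 1 := le_trans (by gcongr) hEt
    have h3 := mul_le_mul_of_nonneg_right h2 hU
    linarith
  have h3 : 8 * k * B * (δ * U) ≤ U / 4 := by
    have h4 : 32 * B * k * δ ≤ 1 := by
      refine le_trans ?_ hδk.le
      have : B ≤ B + 1 := by linarith
      gcongr
    have h5 := mul_le_mul_of_nonneg_right h4 hU
    linarith
  have h4 : 4 * k * (B * (t * lo)) ≤ 4 * k * (B * (f + 2 * (δ * U + B / δ * f))) := by
    have : t * lo ≤ f + 2 * (δ * U + B / δ * f) := by linarith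
    gcongr
  have h5 : 0 ≤ k * B * f := by positivity
  linarith

/-- The a priori estimate for trigonometric polynomials, with a constant proportional to the bound
`k` of the transport operators. The condition `k ≤ k₀` only serves to fix the threshold `T`. -/
theorem exists_norm_trig_le {χ : C(Circ, ℝ)} {β K : ℝ≥0} (hβ : (1 / 2 : ℝ) < β) (hβ1 : β ≤ 1)
    (hχ : HolderWith K β χ) (hχ0 : ∀ x, 0 ≤ χ x) {k₀ : ℝ} (hk₀ : 0 < k₀) :
    ∃ C T : ℝ, 0 < C ∧ 0 < T ∧ ∀ τ : ℝ, T < |τ| → ∀ k, 0 ≤ k → k ≤ k₀ →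
      TransportBound χ τ k → TransportBound χ (-τ) k → ∀ (F : Finset ℤ) (c : ℤ → ℂ),
        ‖toL2 (trig F c)‖ ≤ C * k * ‖PTrig χ τ F c‖ := by
  obtain ⟨C₁, hC₁, hhankel⟩ := exists_norm_freqProj_mul_le hβ1 hχ
  have hB0 : 0 ≤ ‖complexify χ‖ := norm_nonneg _
  have hBχ : ‖χ‖ ≤ ‖complexify χ‖ := (ContinuousMap.norm_le _ hB0).2 fun x => by
    have := (complexify χ).norm_coe_le_norm x
    rwa [complexify_apply, Complex.norm_real] at this
  -- the weight in the arithmetic-geometric mean inequality for `‖χu‖`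
  set δ : ℝ := 1 / (32 * (‖complexify χ‖ + 1) * k₀) with hδ
  have hδ0 : 0 < δ := by positivity
  have hδk : 32 * (‖complexify χ‖ + 1) * k₀ * δ = 1 := mul_one_div_cancel (by positivity)
  have hlim := tendsto_rpow_neg_atTop (show 0 < 2 * (β : ℝ) - 1 by linarith)
  have hev : ∀ᶠ t : ℝ in Filter.atTop,
      t ^ (-(2 * (β : ℝ) - 1)) < 1 / (64 * k₀ * (C₁ + 1)) :=
    hlim.eventually (gt_mem_nhds (by positivity))
  obtain ⟨T, hT⟩ := Filter.eventually_atTop.1 hev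
  refine ⟨2 * (2 + 8 * ‖complexify χ‖ + 8 * ‖complexify χ‖ * (‖complexify χ‖ / δ)), max T 2,
    by positivity, lt_of_lt_of_le two_pos (le_max_right _ _),
    fun τ hτ k hk hk' hpos hneg F c => ?_⟩
  have ht2 : 2 < |τ| := (le_max_right _ _).trans_lt hτ
  have ht0 : 0 < |τ| := by linarith
  have hM0 : 0 < ⌊|τ| ^ 2 / 2⌋₊ := Nat.floor_pos.2 (by nlinarith)
  have hMle : (⌊|τ| ^ 2 / 2⌋₊ : ℝ) ≤ τ ^ 2 / 2 := by
    rw [← sq_abs τ]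
    exact Nat.floor_le (by positivity)
  have hE0 : 0 ≤ C₁ * (⌊|τ| ^ 2 / 2⌋₊ : ℝ) ^ (-(β : ℝ)) := by positivity
  have hEt : 16 * k₀ * (|τ| * (C₁ * (⌊|τ| ^ 2 / 2⌋₊ : ℝ) ^ (-(β : ℝ)))) ≤ 1 := by
    have h1 := rpow_neg_natFloor_le ht2 β.coe_nonneg (show (β : ℝ) ≤ 1 by exact_mod_cast hβ1)
    have h2 := hT |τ| ((le_max_left _ _).trans hτ.le)
    calc _ = 16 * k₀ * (C₁ * (|τ| * (⌊|τ| ^ 2 / 2⌋₊ : ℝ) ^ (-(β : ℝ)))) := by ring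
      _ ≤ 16 * k₀ * ((C₁ + 1) * (4 * (1 / (64 * k₀ * (C₁ + 1))))) := by
          refine mul_le_mul_of_nonneg_left ?_ (by positivity)
          refine mul_le_mul (by linarith) (h1.trans ?_) (by positivity) (by positivity)
          exact mul_le_mul_of_nonneg_left h2.le (by norm_num)
      _ = 1 := by field_simp; norm_num
  exact absorb_error_terms (norm_nonneg _) (norm_nonneg _) (norm_nonneg _) hE0 hB0 hk hk' ht2
    hδ0 hδk hEt (norm_trig_le hE0 (hhankel _ hM0) hk hpos hneg F c)
    (norm_trig_low_le (χ := χ) ht0 hMle F c) (abs_mul_norm_inner_le χ τ F c)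
    ((norm_mulBy_sq_le hχ0 _).trans (mul_le_mul_of_nonneg_right hBχ (norm_nonneg _)))

/-! ### The a priori estimate on `H¹(𝕋)` -/

theorem tendsto_toL2_trig (u : L2) :
    Filter.Tendsto (fun F => toL2 (trig F fun n => coef n u)) Filter.atTop (nhds u) := by
  simp only [toL2_trig]
  exact hasSum_fourier_series_L2 u

theorem norm_le_of_forall_trig {χ : C(Circ, ℝ)} {τ C : ℝ}
    (h : ∀ (F : Finset ℤ) (c : ℤ → ℂ), ‖toL2 (trig F c)‖ ≤ C * ‖PTrig χ τ F c‖) (u : H1) :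
    ‖(u : L2)‖ ≤ C * ‖P χ τ u‖ := by
  have h1 := tendsto_toL2_trig (u : L2)
  have h2 := tendsto_toL2_trig (absD u)
  simp only [coef_absD] at h2
  have h3 : Filter.Tendsto (fun F => PTrig χ τ F fun n => coef n u) Filter.atTop
      (nhds (P χ τ u)) := by
    simp only [PTrig, ← mulBy_toL2, P_apply]
    exact (h2.sub ((((continuous_mulBy χ).tendsto _).comp h1).const_smul _)).sub (h1.const_smul _)
  exact le_of_tendsto_of_tendsto h1.norm (h3.norm.const_mul C)
    (Filter.Eventually.of_forall fun F => h F _)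

/-! ### Invertibility of `P(τ)` -/

theorem coef_eq_inner (n : ℤ) (u : L2) : coef n u = inner ℂ (toL2 (fourier n)) u := by
  rw [coef_eq_repr, fourierBasis.repr_apply_apply, coe_fourierBasis]
  rfl

theorem continuous_coef (n : ℤ) : Continuous (coef n) := by
  have : ⇑(coef n) = fun u => inner ℂ (toL2 (fourier n)) u := funext (coef_eq_inner n)
  rw [this]
  fun_prop

theorem mem_H1_of_coef_eq {u v : L2} (h : ∀ n : ℤ, ((|n| : ℤ) : ℂ) * coef n u = coef n v) :
    u ∈ H1 := by
  rw [mem_H1_iff]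
  simp only [h]
  exact memlp_two_iff.2 (hasSum_norm_coef_sq v).summable

/-- Elliptic regularity: an `L²` solution of `P(τ)u = f` in the sense of Fourier coefficients is in
`H¹`. -/
theorem exists_mem_H1_P_eq {χ : C(Circ, ℝ)} {τ : ℂ} {u f : L2}
    (h : ∀ n : ℤ, (((|n| : ℤ) : ℂ) - τ ^ 2) * coef n u - Complex.I * τ * coef n (mulBy χ u) =
      coef n f) : ∃ hu : u ∈ H1, P χ τ ⟨u, hu⟩ = f := by
  have hu : u ∈ H1 := by
    refine mem_H1_of_coef_eq (v := f + τ ^ 2 • u + (Complex.I * τ) • mulBy χ u) fun n => ?_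
    rw [map_add, map_add, map_smul, map_smul, ← h n, smul_eq_mul, smul_eq_mul]
    ring
  exact ⟨hu, ext_coef fun n => (coef_P χ τ ⟨u, hu⟩ n).trans (h n)⟩

theorem toL2_fourier_mem_H1 (n : ℤ) : toL2 (fourier n) ∈ H1 := by
  refine mem_H1_of_coef_eq (v := ((|n| : ℤ) : ℂ) • toL2 (fourier n)) fun m => ?_
  rw [map_smul, coef_toL2_fourier, smul_eq_mul]
  split_ifs with h
  · rw [h]
  · rw [mul_zero, mul_zero]

theorem inner_P_fourier (χ : C(Circ, ℝ)) (τ : ℝ) (n : ℤ) (v : L2) :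
    inner ℂ (P χ τ ⟨toL2 (fourier n), toL2_fourier_mem_H1 n⟩) v =
      (((|n| : ℤ) : ℂ) - (-τ : ℂ) ^ 2) * coef n v - Complex.I * (-τ : ℂ) * coef n (mulBy χ v) := by
  have h1 : absD ⟨toL2 (fourier n), toL2_fourier_mem_H1 n⟩ =
      ((|n| : ℤ) : ℂ) • toL2 (fourier n) := ext_coef fun m => by
    rw [coef_absD, map_smul, coef_toL2_fourier, smul_eq_mul]
    split_ifs with h
    · rw [h]
    · rw [mul_zero, mul_zero]
  rw [P_apply, h1, inner_sub_left, inner_sub_left, inner_smul_left, inner_smul_left,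
    inner_smul_left, inner_mulBy_left, ← coef_eq_inner, ← coef_eq_inner]
  simp only [map_mul, map_pow, Complex.conj_I, Complex.conj_ofReal, map_intCast]
  ring

/-- The range of `P(τ)` is closed by the a priori estimate for `P(τ)`, and dense by the one for
`P(-τ)`, which is the adjoint of `P(τ)`. -/
theorem exists_isResolvent {χ : C(Circ, ℝ)} {τ C : ℝ} (hC : 0 ≤ C)
    (h : ∀ u : H1, ‖(u : L2)‖ ≤ C * ‖P χ τ u‖)
    (h' : ∀ u : H1, ‖(u : L2)‖ ≤ C * ‖P χ ((-τ : ℝ) : ℂ) u‖) :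
    ∃ R : L2 →L[ℂ] L2, IsResolvent χ τ R ∧ ‖R‖ ≤ C := by
  have hclosed : IsClosed ((P χ τ).range : Set L2) := by
    refine IsSeqClosed.isClosed fun f f₀ hf hlim => ?_
    choose u hu using hf
    have hcauchy : CauchySeq fun m => (u m : L2) := by
      have h1 := hlim.cauchySeq
      rw [Metric.cauchySeq_iff'] at h1 ⊢
      intro ε hε
      obtain ⟨N, hN⟩ := h1 (ε / (C + 1)) (by positivity)
      refine ⟨N, fun n hn => ?_⟩
      have h2 := h (u n - u N)
      rw [map_sub, hu, hu, ← dist_eq_norm] at h2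
      rw [dist_eq_norm]
      have h3 := hN n hn
      rw [lt_div_iff₀ (by positivity)] at h3
      refine lt_of_le_of_lt h2 ?_
      have h4 : 0 ≤ dist (f n) (f N) := dist_nonneg
      linarith
    obtain ⟨u₀, hu₀⟩ := cauchySeq_tendsto_of_complete hcauchy
    obtain ⟨hmem, hP⟩ := exists_mem_H1_P_eq (χ := χ) (τ := τ) (u := u₀) (f := f₀) fun n => by
      have h1 := ((continuous_coef n).tendsto f₀).comp hlim
      have h2 := (((continuous_coef n).tendsto u₀).comp hu₀).const_mul
        (((|n| : ℤ) : ℂ) - (τ : ℂ) ^ 2)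
      have h3 := (((continuous_coef n).comp (continuous_mulBy χ)).tendsto u₀).comp hu₀
      refine tendsto_nhds_unique (h2.sub (h3.const_mul (Complex.I * τ))) (h1.congr fun m => ?_)
      simp only [Function.comp_apply, ← hu m]
      exact coef_P χ τ (u m) n
    exact ⟨⟨u₀, hmem⟩, hP⟩
  have horth : (P χ τ).rangeᗮ = ⊥ := by
    refine (Submodule.eq_bot_iff _).2 fun v hv => ?_
    obtain ⟨hmem, hP⟩ := exists_mem_H1_P_eq (χ := χ) (τ := ((-τ : ℝ) : ℂ)) (u := v) (f := 0)
      fun n => by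
        rw [map_zero, Complex.ofReal_neg, ← inner_P_fourier χ τ n v]
        exact (Submodule.mem_orthogonal _ _).1 hv _ ⟨_, rfl⟩
    have h1 := h' ⟨v, hmem⟩
    rw [hP, norm_zero, mul_zero] at h1
    exact norm_le_zero_iff.1 h1
  have hrange : (P χ τ).range = ⊤ := by
    rw [← hclosed.submodule_topologicalClosure_eq]
    exact Submodule.topologicalClosure_eq_top_iff.2 horth
  have hinj : Function.Injective (P χ τ) := by
    refine (injective_iff_map_eq_zero _).2 fun u hu => ?_
    have h1 := h u
    rw [hu, norm_zero, mul_zero] at h1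
    exact Subtype.ext (norm_le_zero_iff.1 h1)
  set e := LinearEquiv.ofBijective (P χ τ) ⟨hinj, LinearMap.range_eq_top.1 hrange⟩ with he
  have hPe : ∀ f, P χ τ (e.symm f) = f := fun f => e.apply_symm_apply f
  refine ⟨(H1.subtype ∘ₗ e.symm.toLinearMap).mkContinuous C fun f => ?_,
    ⟨fun f => ⟨(e.symm f).2, hPe f⟩, fun u => ?_⟩, LinearMap.mkContinuous_norm_le _ hC _⟩
  · have h1 := h (e.symm f)
    rwa [hPe] at h1
  · exact congrArg Subtype.val (e.symm_apply_apply u)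

/-- Bounds for the transport operators along `+χ` and `-χ` give bounds for `P(τ)⁻¹`. -/
theorem exists_isResolvent_norm_le {χ : C(Circ, ℝ)} {β K : ℝ≥0} (hβ : (1 / 2 : ℝ) < β)
    (hβ1 : β ≤ 1) (hχ : HolderWith K β χ) (hχ0 : ∀ x, 0 ≤ χ x) {k₀ : ℝ} (hk₀ : 0 < k₀) :
    ∃ C T : ℝ, 0 < C ∧ 0 < T ∧ ∀ τ : ℝ, T < |τ| → ∀ k, 0 ≤ k → k ≤ k₀ →
      (∀ a, |a| = |τ| → TransportBound χ a k) →
        ∃ R : L2 →L[ℂ] L2, IsResolvent χ τ R ∧ ‖R‖ ≤ C * k := by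
  obtain ⟨C, T, hC, hT, h⟩ := exists_norm_trig_le hβ hβ1 hχ hχ0 hk₀
  refine ⟨C, T, hC, hT, fun τ hτ k hk hk' hb => exists_isResolvent (by positivity) ?_ ?_⟩
  · exact norm_le_of_forall_trig (h τ hτ k hk hk' (hb _ rfl) (hb _ (abs_neg τ)))
  · refine norm_le_of_forall_trig (h (-τ) (by rwa [abs_neg]) k hk hk' (hb _ (abs_neg τ)) ?_)
    rw [neg_neg]
    exact hb _ rfl

theorem integral_lift_pos {χ : C(Circ, ℝ)} (hχ0 : ∀ x, 0 ≤ χ x) (hχ : χ ≠ 0) :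
    0 < ∫ s in (0 : ℝ)..(2 * π), lift χ s := by
  obtain ⟨x, hx⟩ : ∃ x, χ x ≠ 0 := by
    by_contra! h
    exact hχ (ContinuousMap.ext h)
  obtain ⟨t, ht, rfl⟩ := (AddCircle.coe_image_Icc_eq (2 * π) 0).symm.subset (Set.mem_univ x)
  rw [zero_add] at ht
  exact intervalIntegral.integral_pos Real.two_pi_pos (continuous_lift χ).continuousOn
    (fun _ _ => hχ0 _) ⟨t, ht, (hχ0 _).lt_of_ne' hx⟩

theorem integral_lift_nonneg {χ : C(Circ, ℝ)} (hχ0 : ∀ x, 0 ≤ χ x) {a b : ℝ} (hab : a ≤ b) :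
    0 ≤ ∫ s in a..b, lift χ s :=
  intervalIntegral.integral_nonneg hab fun _ _ => hχ0 _

/-- The uniform resolvent bound, from the trivial majorant `κ = 1` of the propagator. -/
theorem exists_uniform_bound {χ : C(Circ, ℝ)} {β K : ℝ≥0} (hβ : (1 / 2 : ℝ) < β)
    (hβ1 : β ≤ 1) (hχ : HolderWith K β χ) (hχ0 : ∀ x, 0 ≤ χ x) (hχne : χ ≠ 0) :
    ∃ C : ℝ, 0 < C ∧ ∀ τ : ℝ, C < |τ| →
      ∃ R : L2 →L[ℂ] L2, IsResolvent χ (τ : ℂ) R ∧ ‖R‖ ≤ C := by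
  have hA := integral_lift_pos hχ0 hχne
  set k₀ := 2 * π / (1 - exp (-∫ s in (0 : ℝ)..(2 * π), lift χ s)) with hk₀
  have hk₀0 : 0 < k₀ :=
    div_pos Real.two_pi_pos (sub_pos.2 (exp_lt_one_iff.2 (neg_lt_zero.2 hA)))
  obtain ⟨C, T, hC, hT, h⟩ := exists_isResolvent_norm_le hβ hβ1 hχ hχ0 hk₀0
  refine ⟨max (C * k₀) (max T 1), lt_max_of_lt_left (by positivity), fun τ hτ => ?_⟩
  have hT' : T < |τ| := ((le_max_left _ _).trans (le_max_right _ _)).trans_lt hτ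
  have h1 : 1 < |τ| := ((le_max_right _ _).trans (le_max_right _ _)).trans_lt hτ
  obtain ⟨R, hR, hRC⟩ := h τ hT' k₀ hk₀0.le le_rfl fun a ha =>
    transportBound_of_one_le hA (ha ▸ h1.le) (κ := fun _ => 1) continuous_const
      (fun _ => one_pos) (fun x r hr => by
        rw [exp_le_one_iff, neg_mul, neg_nonpos]
        exact mul_nonneg (abs_nonneg a) (integral_lift_nonneg hχ0 (by linarith [hr.1])))
      (by simp)
  exact ⟨R, hR, hRC.trans (le_max_left _ _)⟩

/-! ### Quasimodes supported away from the damping -/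

theorem norm_mul_coef_le_of_hasDerivAt {w v : C(Circ, ℂ)}
    (hw : ∀ t : ℝ, HasDerivAt (fun s : ℝ => w (s : Circ)) (v (t : Circ)) t) (n : ℤ) :
    |(n : ℝ)| * ‖coef n (toL2 w)‖ ≤ ‖coef n (toL2 v)‖ := by
  rcases eq_or_ne n 0 with rfl | hn
  · simp
  have hcoe : Continuous fun r : ℝ => (r : Circ) := AddCircle.continuous_mk' _
  have h1 := fourierCoeffOn_of_hasDerivAt (a := 0) (b := 0 + 2 * π)
    (by linarith [Real.two_pi_pos]) hn (fun t _ => hw t)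
    ((v.continuous.comp hcoe).intervalIntegrable _ _)
  have h2 : ∀ f : C(Circ, ℂ), fourierCoeffOn (a := 0) (b := 0 + 2 * π)
      (by linarith [Real.two_pi_pos]) (fun s : ℝ => f (s : Circ)) n = coef n (toL2 f) := by
    intro f
    rw [coef_toL2, fourierCoeffOn_eq_integral, fourierCoeff_eq_intervalIntegral _ _ 0]
    simp only [fourier_coe_apply, zero_add, sub_zero]
  rw [h2 w] at h1
  rw [h2 v, zero_add, AddCircle.coe_period, Complex.ofReal_zero, AddCircle.coe_zero,
    AddCircle.coe_zero, sub_self,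
    mul_zero, zero_sub,
    sub_zero] at h1
  rw [h1, norm_mul, norm_neg, norm_mul, norm_div]
  have hn' : |(n : ℝ)| ≠ 0 := abs_ne_zero.2 (by exact_mod_cast hn)
  simp only [norm_one, norm_mul, norm_neg, Complex.norm_ofNat, Complex.norm_real, Complex.norm_I,
    Complex.norm_intCast, norm_eq_abs, abs_of_pos pi_pos]
  refine le_of_eq ?_
  have := pi_pos
  field_simp
  rw [abs_two]

theorem norm_toL2_fourier_mul (n : ℤ) (w : C(Circ, ℂ)) :
    ‖toL2 (fourier n * w)‖ = ‖toL2 w‖ := by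
  refine (sq_eq_sq₀ (norm_nonneg _) (norm_nonneg _)).1 ?_
  rw [norm_toL2_sq, norm_toL2_sq]
  refine integral_congr_ae (Filter.Eventually.of_forall fun t => ?_)
  have : ‖(fourier n t : ℂ)‖ = 1 := by
    rw [fourier_apply]
    exact Circle.norm_coe _
  simp only [ContinuousMap.mul_apply, norm_mul, this, one_mul]

/-- If `χw = 0` then `e^{inx} w` is an `O(1)` quasimode of `P(√n)`, because
`||m| - n| ≤ |m - n|`. -/
theorem exists_quasimode {χ : C(Circ, ℝ)} {w v : C(Circ, ℂ)}
    (hw : ∀ t : ℝ, HasDerivAt (fun s : ℝ => w (s : Circ)) (v (t : Circ)) t)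
    (hχw : ∀ x, χ x ≠ 0 → w x = 0) (n : ℕ) :
    ∃ u : H1, ‖(u : L2)‖ = ‖toL2 w‖ ∧ ‖P χ ((√n : ℝ) : ℂ) u‖ ≤ ‖toL2 v‖ := by
  set u := toL2 (fourier (n : ℤ) * w) with hu
  have hcoef : ∀ m : ℤ, coef m u = coef (m - n) (toL2 w) := fun m => coef_toL2_fourier_mul _ _ _
  have hmul : mulBy χ u = 0 := by
    rw [hu, mulBy_toL2]
    have : complexify χ * (fourier (n : ℤ) * w) = 0 := by
      ext x
      rw [ContinuousMap.mul_apply, ContinuousMap.mul_apply, complexify_apply,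
        ContinuousMap.zero_apply]
      by_cases h : χ x = 0
      · rw [h, Complex.ofReal_zero, zero_mul]
      · rw [hχw x h, mul_zero, mul_zero]
    rw [this, map_zero]
  have hle : ∀ m : ℤ, ‖(((|m| : ℤ) : ℂ) - n) * coef m u‖ ≤
      ‖coef m (toL2 (fourier (n : ℤ) * v))‖ := by
    intro m
    rw [hcoef, coef_toL2_fourier_mul, norm_mul]
    refine le_trans (mul_le_mul_of_nonneg_right ?_ (norm_nonneg _))
      (norm_mul_coef_le_of_hasDerivAt hw (m - n))
    have h1 : (((|m| : ℤ) : ℂ) - n) = ((|m| - n : ℤ) : ℂ) := by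
      rw [Int.cast_sub, Int.cast_natCast]
    rw [h1, Complex.norm_intCast]
    have h2 : |(|m| - n : ℤ)| ≤ |m - n| := by
      have := abs_abs_sub_abs_le_abs_sub m n
      rwa [Nat.abs_cast] at this
    exact_mod_cast h2
  have hsum : Memℓp (fun m : ℤ => (((|m| : ℤ) : ℂ) - n) * coef m u) 2 := by
    rw [memlp_two_iff]
    refine Summable.of_nonneg_of_le (fun m => by positivity) (fun m => ?_)
      (hasSum_norm_coef_sq (toL2 (fourier (n : ℤ) * v))).summable
    exact pow_le_pow_left₀ (norm_nonneg _) (hle m) 2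
  obtain ⟨f, hf⟩ := exists_coef_eq hsum
  obtain ⟨hmem, hP⟩ := exists_mem_H1_P_eq (χ := χ) (τ := ((√n : ℝ) : ℂ)) (u := u) (f := f)
    fun m => by
      rw [hmul, map_zero, mul_zero, sub_zero, hf, ← Complex.ofReal_pow,
        Real.sq_sqrt (Nat.cast_nonneg n), Complex.ofReal_natCast]
  refine ⟨⟨u, hmem⟩, norm_toL2_fourier_mul _ _, ?_⟩
  rw [hP, ← norm_toL2_fourier_mul n v, ← one_mul ‖toL2 (fourier (n : ℤ) * v)‖]
  refine norm_le_of_coef_le zero_le_one fun m => ?_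
  rw [hf, one_mul]
  exact hle m

theorem exists_continuousMap_lift {f : ℝ → ℂ} (hf : Continuous f)
    (hper : Function.Periodic f (2 * π)) : ∃ w : C(Circ, ℂ), ∀ t : ℝ, w (t : Circ) = f t :=
  ⟨⟨hper.lift, continuous_coinduced_dom.2 hf⟩, fun t => hper.lift_coe t⟩

/-- A smooth bump on the circle where `χ` vanishes: `ψ (cos (t - t₀) - cos r)`, with `ψ` a smooth
function that vanishes exactly on the nonpositive reals. -/
theorem exists_bump {χ : C(Circ, ℝ)} (hχ : tsupport χ ≠ Set.univ) :
    ∃ w v : C(Circ, ℂ), w ≠ 0 ∧ (∀ x, χ x ≠ 0 → w x = 0) ∧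
      ∀ t : ℝ, HasDerivAt (fun s : ℝ => w (s : Circ)) (v (t : Circ)) t := by
  obtain ⟨x₀, hx₀⟩ := (Set.ne_univ_iff_exists_notMem _).1 hχ
  obtain ⟨t₀, rfl⟩ := QuotientAddGroup.mk_surjective x₀
  obtain ⟨ε, hε, hball⟩ := Metric.isOpen_iff.1 (isClosed_tsupport χ).isOpen_compl _ hx₀
  set r := min ε π with hr
  have hr0 : 0 < r := lt_min hε pi_pos
  set f : ℝ → ℝ := fun t => smoothTransition (cos (t - t₀) - cos r) with hf
  have hfc : ContDiff ℝ 1 f := smoothTransition.contDiff.comp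
    ((contDiff_cos.comp (contDiff_id.sub contDiff_const)).sub contDiff_const)
  have hper : Function.Periodic f (2 * π) := fun t => by
    simp only [hf, add_sub_right_comm t (2 * π) t₀, cos_add_two_pi]
  have hper' : Function.Periodic (deriv f) (2 * π) := fun t => by
    rw [← deriv_comp_add_const]
    exact congrArg (deriv · t) (funext hper)
  obtain ⟨w, hw⟩ := exists_continuousMap_lift (f := fun t => (f t : ℂ))
    (Complex.continuous_ofReal.comp hfc.continuous) (fun t => congrArg Complex.ofReal (hper t))
  obtain ⟨v, hv⟩ := exists_continuousMap_lift (f := fun t => ((deriv f t : ℝ) : ℂ))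
    (Complex.continuous_ofReal.comp (hfc.continuous_deriv le_rfl))
    (fun t => congrArg Complex.ofReal (hper' t))
  refine ⟨w, v, fun h0 => ?_, fun x hx => ?_, fun t => ?_⟩
  · have h1 := hw t₀
    have h2 : cos r < 1 := by
      rw [← cos_zero]
      exact cos_lt_cos_of_nonneg_of_le_pi le_rfl (min_le_right _ _) hr0
    have h3 : 0 < f t₀ := smoothTransition.pos_of_pos (by rw [sub_self, cos_zero]; linarith)
    rw [h0, ContinuousMap.zero_apply, eq_comm, Complex.ofReal_eq_zero] at h1
    exact h3.ne' h1
  · obtain ⟨t, ht, rfl⟩ :=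
      (AddCircle.coe_image_Icc_eq (2 * π) (t₀ - π)).symm.subset (Set.mem_univ x)
    rw [hw, Complex.ofReal_eq_zero]
    refine smoothTransition.zero_of_nonpos ?_
    have h1 : |t - t₀| ≤ π := abs_le.2 ⟨by linarith [ht.1], by linarith [ht.2]⟩
    have h2 : r ≤ |t - t₀| := by
      by_contra! h
      refine hball ?_ (subset_tsupport χ hx)
      rw [Metric.mem_ball, dist_eq_norm]
      change ‖((t - t₀ : ℝ) : Circ)‖ < ε
      exact (QuotientAddGroup.norm_mk_le_norm).trans_lt (h.trans_le (min_le_left _ _))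
    have h3 := cos_le_cos_of_nonneg_of_le_pi hr0.le h1 h2
    rw [cos_abs] at h3
    linarith
  · simp only [hw, hv]
    exact ((hfc.differentiable one_ne_zero) t).hasDerivAt.ofReal_comp

/-- Where the damping has a gap, every inverse of `P(√n)` has norm bounded below. -/
theorem exists_le_norm_resolvent {χ : C(Circ, ℝ)} (hχ : tsupport χ ≠ Set.univ) :
    ∃ c : ℝ, 0 < c ∧ ∀ (n : ℕ) (R : L2 →L[ℂ] L2),
      IsResolvent χ ((√n : ℝ) : ℂ) R → c ≤ ‖R‖ := by
  obtain ⟨w, v, hw0, hχw, hw⟩ := exists_bump hχ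
  have hpos : 0 < ‖toL2 w‖ := norm_pos_iff.2 fun h =>
    hw0 (ContinuousMap.toLp_injective (AddCircle.haarAddCircle : Measure Circ)
      (h.trans (map_zero toL2).symm))
  refine ⟨‖toL2 w‖ / (‖toL2 v‖ + 1), by positivity, fun n R hR => ?_⟩
  obtain ⟨u, hu, hPu⟩ := exists_quasimode hw hχw n
  rw [div_le_iff₀ (by positivity), ← hu]
  calc ‖(u : L2)‖ = ‖R (P χ ((√n : ℝ) : ℂ) u)‖ := by rw [hR.2 u]
    _ ≤ ‖R‖ * ‖P χ ((√n : ℝ) : ℂ) u‖ := R.le_opNorm _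
    _ ≤ ‖R‖ * (‖toL2 v‖ + 1) := by gcongr; linarith

theorem tendsto_sqrt_natCast : Filter.Tendsto (fun n : ℕ => √(n : ℝ)) Filter.atTop Filter.atTop :=
  tendsto_sqrt_atTop.comp tendsto_natCast_atTop_atTop

/-! ### Damping with finitely degenerate zeros -/

theorem iteratedDeriv_lift_eq_of_coe_eq (χ : C(Circ, ℝ)) {s t : ℝ} (h : (s : Circ) = t) (l : ℕ) :
    iteratedDeriv l (lift χ) s = iteratedDeriv l (lift χ) t := by
  have h1 : (fun z => lift χ (z + (s - t))) = lift χ := by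
    funext z
    simp only [lift, AddCircle.coe_add, AddCircle.coe_sub, h, sub_self, add_zero]
  have h2 := congrFun (iteratedDeriv_comp_add_const l (lift χ) (s - t)) t
  rw [h1, add_sub_cancel] at h2
  exact h2.symm

theorem VanishesToOrder.of_coe_eq {χ : C(Circ, ℝ)} {s t : ℝ} {m : ℕ}
    (hs : VanishesToOrder χ s m) (h : (s : Circ) = t) : VanishesToOrder χ t m := by
  refine ⟨hs.1, fun l hl => ?_, ?_⟩
  · rw [← iteratedDeriv_lift_eq_of_coe_eq χ h]
    exact hs.2.1 l hl
  · rw [← iteratedDeriv_lift_eq_of_coe_eq χ h]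
    exact hs.2.2

theorem VanishesToOrder.eq_zero {χ : C(Circ, ℝ)} {t : ℝ} {m : ℕ} (h : VanishesToOrder χ t m) :
    χ (t : Circ) = 0 := by
  have := h.2.1 0 (by have := h.1; omega)
  rwa [iteratedDeriv_zero] at this

theorem VanishesToOrder.unique {χ : C(Circ, ℝ)} {t : ℝ} {m m' : ℕ} (h : VanishesToOrder χ t m)
    (h' : VanishesToOrder χ t m') : m = m' := by
  rcases lt_trichotomy m m' with hlt | heq | hlt
  · exact absurd (h'.2.1 (2 * m) (by omega)) h.2.2.ne'
  · exact heq
  · exact absurd (h.2.1 (2 * m') (by omega)) h'.2.2.ne'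

/-- The orders of the zeros are bounded by `maxDegeneracy`: the supremum defining it is over a
finite set. -/
theorem VanishesToOrder.le_maxDegeneracy {χ : C(Circ, ℝ)} (hχ : {x : Circ | χ x = 0}.Finite)
    {t : ℝ} {m : ℕ} (h : VanishesToOrder χ t m) : m ≤ maxDegeneracy χ := by
  refine le_csSup (Set.Finite.bddAbove ?_) ⟨t, h⟩
  refine (hχ.biUnion fun x _ => (Set.Subsingleton.finite
    (s := {m | ∃ t : ℝ, (t : Circ) = x ∧ VanishesToOrder χ t m}) ?_)).subset ?_
  · rintro m ⟨t, rfl, hm⟩ m' ⟨t', ht', hm'⟩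
    exact hm.unique (hm'.of_coe_eq ht')
  · rintro m ⟨t, hm⟩
    exact Set.mem_biUnion (show (t : Circ) ∈ {x : Circ | χ x = 0} from hm.eq_zero) ⟨t, rfl, hm⟩

/-- Taylor's formula at a zero of order `p`. -/
theorem exists_mul_pow_le_of_iteratedDeriv {f : ℝ → ℝ} {x₀ : ℝ} {p : ℕ} (hf : ContDiff ℝ p f)
    (h0 : ∀ l < p, iteratedDeriv l f x₀ = 0) (hp : 0 < iteratedDeriv p f x₀) (heven : Even p) :
    ∃ c : ℝ, 0 < c ∧ ∀ᶠ x in nhds x₀, c * (x - x₀) ^ p ≤ f x := by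
  have h1 := taylor_isLittleO_univ (x₀ := x₀) hf
  set D := (p.factorial : ℝ)⁻¹ * iteratedDeriv p f x₀ with hD
  have hD0 : 0 < D := by positivity
  have h2 : ∀ x, taylorWithinEval f p Set.univ x₀ x = D * (x - x₀) ^ p := by
    intro x
    rw [taylor_within_apply, Finset.sum_range_succ, Finset.sum_eq_zero]
    · rw [iteratedDerivWithin_univ, zero_add, smul_eq_mul, hD]
      ring
    · intro k hk
      rw [iteratedDerivWithin_univ, h0 k (Finset.mem_range.1 hk), smul_zero]
  refine ⟨D / 2, by positivity, ?_⟩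
  filter_upwards [h1.bound (show 0 < D / 2 by positivity)] with x hx
  have h3 : 0 ≤ (x - x₀) ^ p := heven.pow_nonneg _
  rw [h2, norm_eq_abs, norm_eq_abs, abs_of_nonneg h3] at hx
  have := (abs_le.1 hx).1
  linarith

/-- The bound holds because the first or the last quarter of `[a, b]` stays away from `x₀` by a
quarter of the length. -/
theorem mul_pow_le_integral {f : ℝ → ℝ} (hf : Continuous f) (hf0 : ∀ x, 0 ≤ f x) {a b x₀ c : ℝ}
    {p : ℕ} (hab : a ≤ b) (hc : 0 ≤ c) (h : ∀ x ∈ Set.Icc a b, c * |x - x₀| ^ p ≤ f x) :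
    c * ((b - a) / 4) ^ (p + 1) ≤ ∫ x in a..b, f x := by
  have key : ∀ u v, a ≤ u → v ≤ b → v - u = (b - a) / 4 →
      (∀ x ∈ Set.Icc u v, (b - a) / 4 ≤ |x - x₀|) →
      c * ((b - a) / 4) ^ (p + 1) ≤ ∫ x in a..b, f x := by
    intro u v hu hv huv hx
    have huv' : u ≤ v := by linarith
    have h1 : ∫ x in u..v, f x ≤ ∫ x in a..b, f x :=
      intervalIntegral.integral_mono_interval hu huv' hv (Filter.Eventually.of_forall hf0)
        (hf.intervalIntegrable _ _)
    have h2 : ∫ _ in u..v, c * ((b - a) / 4) ^ p ≤ ∫ x in u..v, f x := by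
      refine intervalIntegral.integral_mono_on huv' (by simp) (hf.intervalIntegrable _ _)
        fun x hxm => ?_
      refine le_trans (mul_le_mul_of_nonneg_left ?_ hc) (h x ⟨hu.trans hxm.1, hxm.2.trans hv⟩)
      exact pow_le_pow_left₀ (by linarith) (hx x hxm) p
    rw [intervalIntegral.integral_const, huv, smul_eq_mul] at h2
    refine le_trans (le_of_eq ?_) (h2.trans h1)
    ring
  rcases le_total x₀ ((a + b) / 2) with hx₀ | hx₀
  · refine key (b - (b - a) / 4) b (by linarith) le_rfl (by ring) fun x hx => ?_
    exact le_trans (by linarith [hx.1]) (le_abs_self _)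
  · refine key a (a + (b - a) / 4) le_rfl (by linarith) (by ring) fun x hx => ?_
    exact le_trans (by linarith [hx.2]) (neg_le_abs _)

theorem FiniteDegeneracy.exists_local_lower_bound {χ : C(Circ, ℝ)} (hχ : FiniteDegeneracy χ)
    (x₀ : ℝ) : ∃ c : ℝ, 0 < c ∧ ∃ m ≤ maxDegeneracy χ,
      ∀ᶠ x in nhds x₀, c * |x - x₀| ^ (2 * m) ≤ lift χ x := by
  by_cases h0 : lift χ x₀ = 0
  · obtain ⟨m, hm⟩ := hχ.2.2.2 x₀ h0
    obtain ⟨c, hc, h⟩ := exists_mul_pow_le_of_iteratedDeriv (p := 2 * m)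
      (contDiff_infty.1 hχ.1 (2 * m)) hm.2.1 hm.2.2 (even_two_mul m)
    refine ⟨c, hc, m, hm.le_maxDegeneracy hχ.2.2.1, ?_⟩
    simpa only [(even_two_mul m).pow_abs] using h
  · have hpos : 0 < lift χ x₀ := (hχ.2.1 _).lt_of_ne' h0
    refine ⟨lift χ x₀ / 2, by positivity, 0, Nat.zero_le _, ?_⟩
    filter_upwards [(continuous_lift χ).continuousAt.eventually
      (lt_mem_nhds (half_lt_self hpos))] with x hx
    simpa using hx.le

theorem FiniteDegeneracy.exists_short_interval_bound {χ : C(Circ, ℝ)} (hχ : FiniteDegeneracy χ) :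
    ∃ δ c : ℝ, 0 < δ ∧ 0 < c ∧ ∀ a b : ℝ, a ≤ b → b ≤ a + δ →
      c * (b - a) ^ (2 * maxDegeneracy χ + 1) ≤ ∫ x in a..b, lift χ x := by
  set N := maxDegeneracy χ with hN
  have hloc : ∃ δ c : ℝ, 0 < δ ∧ 0 < c ∧ ∀ a ∈ Set.Icc 0 (2 * π), ∀ b, a ≤ b → b ≤ a + δ →
      c * (b - a) ^ (2 * N + 1) ≤ ∫ x in a..b, lift χ x := by
    refine isCompact_Icc.induction_on
      (p := fun s => ∃ δ c : ℝ, 0 < δ ∧ 0 < c ∧ ∀ a ∈ s, ∀ b, a ≤ b → b ≤ a + δ →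
        c * (b - a) ^ (2 * N + 1) ≤ ∫ x in a..b, lift χ x) ?_ ?_ ?_ ?_
    · exact ⟨1, 1, one_pos, one_pos, fun a ha => absurd ha (Set.notMem_empty a)⟩
    · rintro s t hst ⟨δ, c, hδ, hc, h⟩
      exact ⟨δ, c, hδ, hc, fun a ha => h a (hst ha)⟩
    · rintro s t ⟨δ, c, hδ, hc, h⟩ ⟨δ', c', hδ', hc', h'⟩
      refine ⟨min δ δ', min c c', lt_min hδ hδ', lt_min hc hc', fun a ha b hab hb => ?_⟩
      have hpow : 0 ≤ (b - a) ^ (2 * N + 1) := pow_nonneg (sub_nonneg.2 hab) _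
      rcases ha with ha | ha
      · exact (mul_le_mul_of_nonneg_right (min_le_left _ _) hpow).trans
          (h a ha b hab (hb.trans (by linarith [min_le_left δ δ'])))
      · exact (mul_le_mul_of_nonneg_right (min_le_right _ _) hpow).trans
          (h' a ha b hab (hb.trans (by linarith [min_le_right δ δ'])))
    · intro x₀ _
      obtain ⟨c, hc, m, hm, hev⟩ := hχ.exists_local_lower_bound x₀
      obtain ⟨r, hr, hball⟩ := Metric.eventually_nhds_iff_ball.1 hev
      refine ⟨Metric.ball x₀ (r / 2),
        mem_nhdsWithin_of_mem_nhds (Metric.ball_mem_nhds _ (half_pos hr)),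
        min (r / 2) 1 / 2, c / 4 ^ (2 * N + 1), by positivity, by positivity,
        fun a ha b hab hb => ?_⟩
      have hmin1 := min_le_left (r / 2) 1
      have hmin2 := min_le_right (r / 2) 1
      have ha' := abs_lt.1 (Metric.mem_ball.1 ha)
      have h1 := mul_pow_le_integral (continuous_lift χ) (fun x => hχ.2.1 _) hab hc.le
        (x₀ := x₀) (p := 2 * m) fun x hx => hball x (by
          rw [Metric.mem_ball, dist_eq, abs_lt]
          constructor <;> linarith [hx.1, hx.2])
      refine le_trans ?_ h1
      rw [div_mul_eq_mul_div, mul_div_assoc, ← div_pow]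
      refine mul_le_mul_of_nonneg_left ?_ hc.le
      exact pow_le_pow_of_le_one (by linarith) (by linarith) (by omega)
  obtain ⟨δ, c, hδ, hc, h⟩ := hloc
  refine ⟨δ, c, hδ, hc, fun a b hab hb => ?_⟩
  obtain ⟨a', ha', haa'⟩ :=
    (AddCircle.coe_image_Icc_eq (2 * π) 0).symm.subset (Set.mem_univ (a : Circ))
  rw [zero_add] at ha'
  have h1 := h a' ha' (a' + (b - a)) (by linarith) (by linarith)
  rw [add_sub_cancel_left] at h1
  refine h1.trans (le_of_eq ?_)
  have h2 : (fun x => lift χ (x + (a - a'))) = lift χ := by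
    funext x
    simp only [lift, AddCircle.coe_add, AddCircle.coe_sub, haa', sub_self, add_zero]
  have h3 := intervalIntegral.integral_comp_add_right (a := a') (b := a' + (b - a))
    (lift χ) (a - a')
  rw [h2] at h3
  rw [h3]
  congr 1 <;> ring

/-- The damping accumulated over an interval of length `r` is at least of order `r ^ (2N + 1)`,
the worst case being an interval around a zero of maximal order. -/
theorem FiniteDegeneracy.exists_integral_lower_bound {χ : C(Circ, ℝ)} (hχ : FiniteDegeneracy χ) :
    ∃ c : ℝ, 0 < c ∧ ∀ x, ∀ r ∈ Set.Icc 0 (2 * π),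
      c * r ^ (2 * maxDegeneracy χ + 1) ≤ ∫ s in (x - r)..x, lift χ s := by
  obtain ⟨δ, c, hδ, hc, h⟩ := hχ.exists_short_interval_bound
  set d := min δ (2 * π) with hd
  have hd0 : 0 < d := lt_min hδ Real.two_pi_pos
  refine ⟨c * (d / (2 * π)) ^ (2 * maxDegeneracy χ + 1), by positivity, fun x r hr => ?_⟩
  -- an interval of length `d r / 2π` is short enough for the local bound
  set l := d / (2 * π) * r with hl
  have hl0 : 0 ≤ l := mul_nonneg (by positivity) hr.1
  have hlr : l ≤ r := by
    refine mul_le_of_le_one_left hr.1 ?_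
    rw [div_le_one Real.two_pi_pos]
    exact min_le_right _ _
  have hld : l ≤ δ := by
    refine le_trans ?_ (min_le_left δ (2 * π))
    rw [hl, div_mul_eq_mul_div, div_le_iff₀ Real.two_pi_pos]
    exact mul_le_mul_of_nonneg_left hr.2 hd0.le
  have h1 := h (x - l) x (by linarith) (by linarith)
  rw [sub_sub_cancel] at h1
  rw [mul_assoc, ← mul_pow]
  exact h1.trans (intervalIntegral.integral_mono_interval (by linarith) (by linarith) le_rfl
    (Filter.Eventually.of_forall fun s => hχ.2.1 _) ((continuous_lift χ).intervalIntegrable _ _))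

theorem integral_exp_neg_mul_pow_le {b : ℝ} (hb : 0 < b) (q : ℕ) (hq : 0 < q) {L : ℝ}
    (hL : 0 ≤ L) :
    ∫ r in (0 : ℝ)..L, exp (-b * r ^ q) ≤ b ^ (-1 / (q : ℝ)) * Gamma (1 / (q : ℝ) + 1) := by
  have hq' : (0 : ℝ) < q := by exact_mod_cast hq
  have h1 := integral_exp_neg_mul_rpow hq' hb
  simp only [rpow_natCast] at h1
  have hpos : 0 < b ^ (-1 / (q : ℝ)) * Gamma (1 / (q : ℝ) + 1) :=
    mul_pos (by positivity) (Gamma_pos_of_pos (by positivity))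
  have hint : IntegrableOn (fun r => exp (-b * r ^ q)) (Set.Ioi 0) := by
    by_contra hni
    rw [integral_undef hni] at h1
    exact hpos.ne h1
  rw [intervalIntegral.integral_of_le hL, ← h1]
  exact setIntegral_mono_set hint (Filter.Eventually.of_forall fun r => (exp_pos _).le)
    Set.Ioc_subset_Ioi_self.eventuallyLE

/-- The resolvent bound for finite degeneracy, without loss in the exponent. -/
theorem FiniteDegeneracy.exists_bound {χ : C(Circ, ℝ)} (hfd : FiniteDegeneracy χ) {β K : ℝ≥0}
    (hβ : (1 / 2 : ℝ) < β) (hβ1 : β ≤ 1) (hχ : HolderWith K β χ) (hχne : χ ≠ 0) :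
    ∃ C T : ℝ, 0 < C ∧ 0 < T ∧ ∀ τ : ℝ, T < |τ| →
      ∃ R : L2 →L[ℂ] L2, IsResolvent χ (τ : ℂ) R ∧
        ‖R‖ ≤ C * |τ| ^ (-(1 / (2 * (maxDegeneracy χ : ℝ) + 1))) := by
  have hA := integral_lift_pos hfd.2.1 hχne
  obtain ⟨c, hc, hlow⟩ := hfd.exists_integral_lower_bound
  set q := 2 * maxDegeneracy χ + 1 with hq
  have hqcast : (q : ℝ) = 2 * (maxDegeneracy χ : ℝ) + 1 := by rw [hq]; push_cast; ring
  have hq0 : (0 : ℝ) < q := by rw [hqcast]; positivity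
  have hΓ : 0 < Gamma (1 / (q : ℝ) + 1) := Gamma_pos_of_pos (by positivity)
  set A := ∫ s in (0 : ℝ)..(2 * π), lift χ s
  have hb : 0 < 1 - exp (-A) := sub_pos.2 (exp_lt_one_iff.2 (neg_lt_zero.2 hA))
  set k₀ := c ^ (-1 / (q : ℝ)) * Gamma (1 / (q : ℝ) + 1) / (1 - exp (-A)) with hk₀
  have hk₀0 : 0 < k₀ := by positivity
  obtain ⟨C, T, hC, hT, h⟩ := exists_isResolvent_norm_le hβ hβ1 hχ hfd.2.1 hk₀0
  refine ⟨C * k₀, max T 1, by positivity, lt_max_of_lt_left hT, fun τ hτ => ?_⟩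
  have hT' : T < |τ| := (le_max_left _ _).trans_lt hτ
  have h1 : 1 < |τ| := (le_max_right _ _).trans_lt hτ
  have hle1 : |τ| ^ (-(1 / (q : ℝ))) ≤ 1 :=
    rpow_le_one_of_one_le_of_nonpos h1.le (by rw [neg_nonpos]; positivity)
  rw [← hqcast, mul_assoc]
  refine h τ hT' _ (by positivity) (mul_le_of_le_one_right hk₀0.le hle1) fun a ha => ?_
  have hτ0 : 0 < |τ| := by linarith
  have h2 := transportBound_of_one_le hA (a := a) (ha ▸ h1.le)
    (κ := fun r => exp (-(|τ| * c) * r ^ q)) (by fun_prop) (fun _ => exp_pos _)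
    (fun x r hr => by
      rw [ha, exp_le_exp]
      have := mul_le_mul_of_nonneg_left (hlow x r hr) hτ0.le
      linarith)
    (integral_exp_neg_mul_pow_le (by positivity) q (by omega) Real.two_pi_pos.le)
  refine h2.mono (le_of_eq ?_)
  rw [mul_rpow hτ0.le hc.le, hk₀, neg_div]
  ring

end DampedWave

theorem theorem2 (χ : C(DampedWave.Circ, ℝ)) (β : ℝ≥0) (hβ : (1 / 2 : ℝ) < β) (hβ1 : β ≤ 1)
    (hχ : ∃ K : ℝ≥0, HolderWith K β χ) (hχ_nonneg : ∀ x, 0 ≤ χ x) (hχ_ne : χ ≠ 0) :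
    -- the uniform bound
    (∃ C : ℝ, 0 < C ∧ ∀ τ : ℝ, C < |τ| →
      ∃ R : DampedWave.L2 →L[ℂ] DampedWave.L2,
        DampedWave.IsResolvent χ (τ : ℂ) R ∧ ‖R‖ ≤ C) ∧
    -- its sharpness when the support of `χ` is not the whole circle
    (tsupport χ ≠ Set.univ →
      (∃ c : ℝ, 0 < c ∧ ∀ T : ℝ, ∃ τ : ℝ, T < τ ∧
        ∃ R : DampedWave.L2 →L[ℂ] DampedWave.L2,
          DampedWave.IsResolvent χ (τ : ℂ) R ∧ c ≤ ‖R‖) ∧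
      ¬ ∃ δ : ℝ, 0 < δ ∧ ∃ C : ℝ, 0 < C ∧ ∀ τ : ℝ, C < |τ| →
        ∃ R : DampedWave.L2 →L[ℂ] DampedWave.L2,
          DampedWave.IsResolvent χ (τ : ℂ) R ∧ ‖R‖ ≤ C * |τ| ^ (-δ)) ∧
    -- the improved bound for finite degeneracy
    (DampedWave.FiniteDegeneracy χ → ∀ γ' : ℝ, 0 < γ' →
      ∃ C : ℝ, 0 < C ∧ ∀ τ : ℝ, C < |τ| →
        ∃ R : DampedWave.L2 →L[ℂ] DampedWave.L2,
          DampedWave.IsResolvent χ (τ : ℂ) R ∧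
          ‖R‖ ≤ C * |τ| ^ (-(1 / (2 * (DampedWave.maxDegeneracy χ : ℝ) + 1)) + γ')) := by
  obtain ⟨K, hK⟩ := hχ
  obtain ⟨C₀, hC₀, hunif⟩ := DampedWave.exists_uniform_bound hβ hβ1 hK hχ_nonneg hχ_ne
  refine ⟨⟨C₀, hC₀, hunif⟩, fun hsupp => ?_, fun hfd γ' hγ' => ?_⟩
  · obtain ⟨c, hc, hlow⟩ := DampedWave.exists_le_norm_resolvent hsupp
    have hlarge : ∀ T : ℝ, ∃ n : ℕ, T < √(n : ℝ) := fun T =>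
      (DampedWave.tendsto_sqrt_natCast.eventually (Filter.eventually_gt_atTop T)).exists
    refine ⟨⟨c, hc, fun T => ?_⟩, ?_⟩
    · obtain ⟨n, hn⟩ := hlarge (max T C₀)
      obtain ⟨R, hR, -⟩ := hunif (√(n : ℝ))
        (((le_max_right _ _).trans_lt hn).trans_le (le_abs_self _))
      exact ⟨√(n : ℝ), (le_max_left _ _).trans_lt hn, R, hR, hlow n R hR⟩
    · rintro ⟨δ, hδ, C, hC, h⟩
      have hlim := (tendsto_rpow_neg_atTop hδ).comp DampedWave.tendsto_sqrt_natCast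
      have hev := hlim.eventually (gt_mem_nhds (show 0 < c / C by positivity))
      obtain ⟨n, hn, hnC⟩ := (hev.and (DampedWave.tendsto_sqrt_natCast.eventually
        (Filter.eventually_gt_atTop C))).exists
      obtain ⟨R, hR, hRle⟩ := h (√(n : ℝ)) (hnC.trans_le (le_abs_self _))
      rw [Function.comp_apply, lt_div_iff₀' hC] at hn
      rw [abs_of_nonneg (Real.sqrt_nonneg _)] at hRle
      exact absurd (hlow n R hR) (not_le.2 (hRle.trans_lt hn))
  · obtain ⟨C, T, hC, hT, h⟩ := hfd.exists_bound hβ hβ1 hK hχ_ne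
    refine ⟨max C (max T 1), lt_max_of_lt_left hC, fun τ hτ => ?_⟩
    have hT' : T < |τ| := ((le_max_left _ _).trans (le_max_right _ _)).trans_lt hτ
    have h1 : 1 < |τ| := ((le_max_right _ _).trans (le_max_right _ _)).trans_lt hτ
    obtain ⟨R, hR, hRC⟩ := h τ hT'
    refine ⟨R, hR, hRC.trans ?_⟩
    refine mul_le_mul (le_max_left _ _) ?_ (by positivity) (by positivity)
    exact rpow_le_rpow_of_exponent_le h1.le (by linarith)
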